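/- Let $\alpha\ge 1/2$ and $\lambda>0$, let $\gamma_{\alpha,\lambda}(u)=\frac{\lambda^\alpha}{\Gamma(\alpha)}u^{\alpha-1}e^{-\lambda u}$, $u>0$, be the density of the gamma law of shape $\alpha$ and rate $\lambda$, and let $X$ be an almost surely positive random variable with $\mathbb E[X^{\alpha+4}]<\infty$ (the law $\mathbb P_X$ of $X$ need not have a density). For $\tau\in(0,1)$ let $X_\tau$ be the gamma smart path $$X_\tau=(1-\tau)\,\gamma(\alpha,\lambda)+\tau\,Y_\tau ,$$ where $\gamma(\alpha,\lambda)$ has density $\gamma_{\alpha,\lambda}$ and is independent of $Y_\tau$, and where $Y_\tau$ is drawn as follows: draw $x$ from $\mathbb P_X$; given $x$, draw $k$ from the Poisson law of parameter $x\lambda\tau/(1-\tau)$; given $k$, let $Y_\tau$ be a gamma random variable of shape $k$ and rate $\lambda\tau/(1-\tau)$, with $Y_\tau=0$ if $k=0$. Then for every $\tau\in(0,1)$ the law of $X_\tau$ has on $(0,\infty)$ the density $$g_\tau(u)=\frac{\lambda}{1-\tau}\Big(\frac u\tau\Big)^{\frac{\alpha-1}2}e^{-\frac{\lambda u}{1-\tau}}\int_{(0,\infty)}\Big(\frac1x\Big)^{\frac{\alpha-1}2}e^{-\frac{\lambda\tau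 x}{1-\tau}}\,I_{\alpha-1}\Big(\frac{2\lambda\sqrt{ux\tau}}{1-\tau}\Big)\,\mathbb P_X(dx),$$ where $I_\nu$ is the modified Bessel function of the first kind of order $\nu$; this density is positive and differentiable on $(0,\infty)$. With the relative entropy $$D(X_\tau\|\gamma_{\alpha,\lambda})=\int_0^\infty g_\tau(u)\log\frac{g_\tau(u)}{\gamma_{\alpha,\lambda}(u)}\,du$$ and the standardized Fisher information $$J_{st,\gamma}(X_\tau)=\mathbb E\Big[X_\tau\Big(\rho_\tau(X_\tau)-\frac{\alpha-1}{X_\tau}+\lambda\Big)^2\Big],\qquad \rho_\tau=(\log g_\tau)',$$ both $D(X_\tau\|\gamma_{\alpha,\lambda})$ and $J_{st,\gamma}(X_\tau)$ are finite, the function $\tau\mapsto D(X_\tau\|\gamma_{\alpha,\lambda})$ is differentiable on $(0,1)$, and $$\frac{d}{d\tau}D(X_\tau\|\gamma_{\alpha,\lambda})=\frac{1}{\lambda\tau}\,J_{st,\gamma}(X_\tau)\qquad\text{for all }\tau\in(0,1).$$ -/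

import Mathlib

open MeasureTheory ProbabilityTheory Set
open scoped ENNReal NNReal

noncomputable section

namespace GammaSmartPath

/-- Given `x`, a Poisson random variable of parameter `r * x`. -/
def poissonKernel (r : ℝ) : Kernel ℝ ℕ where
  toFun x := poissonMeasure (r * x).toNNReal
  measurable' := by
    refine Measure.measurable_of_measurable_coe _ fun s _ => ?_
    simp only [poissonMeasure, Measure.sum_apply_of_countable, Measure.smul_apply, smul_eq_mul]
    fun_prop

/-- Given `k`, a gamma random variable of shape `k` and rate `r`; it is `0` almost surely when
`k = 0`. -/
def integerGammaKernel (r : ℝ) : Kernel ℕ ℝ :=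
  Kernel.ofFunOfCountable fun k => if k = 0 then Measure.dirac 0 else gammaMeasure k r

/-- The law of `Y(τ, X, lam)`, where `μ` is the law of `X`: draw `x` from `μ`, then `k` from the
Poisson law of parameter `x * lam * τ / (1 - τ)`, then a gamma random variable of shape `k` and
rate `lam * τ / (1 - τ)`. -/
def mixtureLaw (lam τ : ℝ) (μ : Measure ℝ) : Measure ℝ :=
  (μ.bind (poissonKernel (lam * τ / (1 - τ)))).bind (integerGammaKernel (lam * τ / (1 - τ)))

/-- The law of `X_τ = (1 - τ) γ(α, lam) + τ Y(τ, X, lam)`, the two summands being independent,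
where `μ` is the law of `X`. -/
def smartPathLaw (α lam τ : ℝ) (μ : Measure ℝ) : Measure ℝ :=
  ((gammaMeasure α lam).prod (mixtureLaw lam τ μ)).map fun p => (1 - τ) * p.1 + τ * p.2

/-- The modified Bessel function of the first kind of order `ν`, at `z > 0`. -/
def besselI (ν z : ℝ) : ℝ :=
  ∑' n : ℕ, (z / 2) ^ (2 * (n : ℝ) + ν) / ((n.factorial : ℝ) * Real.Gamma ((n : ℝ) + ν + 1))

/-- The density `u ↦ g(τ, u)` on `(0, ∞)` of the smart path, where `μ` is the law of `X`. -/
def smartPathDensity (α lam τ : ℝ) (μ : Measure ℝ) (u : ℝ) : ℝ :=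
  lam / (1 - τ) * (u / τ) ^ ((α - 1) / 2) * Real.exp (-(lam * u / (1 - τ))) *
    ∫ x in Ioi (0 : ℝ), (1 / x) ^ ((α - 1) / 2) * Real.exp (-(lam * τ * x / (1 - τ))) *
      besselI (α - 1) (2 * lam * √(u * x * τ) / (1 - τ)) ∂μ

/-- The score `(log f)'` of a density `f`. -/
def score (f : ℝ → ℝ) (u : ℝ) : ℝ := deriv (fun v => Real.log (f v)) u

/-- The score of the gamma law of shape `α` and rate `lam`. -/
def gammaScore (α lam u : ℝ) : ℝ := (α - 1) / u - lam

/-- The standardized Fisher information with respect to the gamma law,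
`J(Y) = E[Y (ρ_Y(Y) - ρ_{α,lam}(Y))²]`, of a positive random variable `Y` of density `f`. -/
def gammaFisherInfo (α lam : ℝ) (f : ℝ → ℝ) : ℝ≥0∞ :=
  ∫⁻ u in Ioi (0 : ℝ), ENNReal.ofReal (u * (score f u - gammaScore α lam u) ^ 2 * f u)

end GammaSmartPath

end

/-!
The smart path from a point `x` has an explicit density. Put `c = lam / (1 - τ)`. Given the Poisson
variable `k`, of parameter `(c - lam) x`, both summands of `X_τ` are gamma variables of rate `c`, so
that `X_τ` is a gamma variable of shape `α + k` and rate `c`; this is proved with moment generating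
functions (`map_prod_integerGammaKernel`). Summing over `k` gives the density
`q_c(u, x) = c ^ α u ^ (α - 1) exp (-c u - (c - lam) x) ψ(c (c - lam) u x)` (`pathKernel`), where
`ψ` is the entire function `besselClifford α`; `I_{α - 1}(2 √z)` is a power of `z` times `ψ(z)`. The
density `g` of `X_τ` is the average of `q_c(u, x)` over the law of `X`.

The differential equation `z ψ'' + α ψ' = ψ` turns into the evolution equation
`∂Φ/∂u = -c (c - lam) ∂g/∂c` for the flux `Φ = u (∂g/∂u - gammaScore * g)`
(`hasDerivAt_pathFlux`, `hasDerivAt_mixFlux`). The relative entropy is the integral of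
`γ klFun(g / γ)`, where `γ` is the gamma density, and `klFun' = log`. Hence its derivative in `c` is
`∫ ∂g/∂c log (g / γ)`, which an integration by parts turns into `∫ Φ² / (u g)` divided by
`c (c - lam)`. The last integral is the Fisher information, because the score of `g` exceeds that of
the gamma law by `Φ / (u g)`.

All the analysis rests on one domination, `exists_pathKernel_mul_le`: for `c` in a bounded range,
`q_c(u, x) (1 + u + x) ^ 3 ≤ C u ^ (α - 1) (1 + u) ^ (-(α + 1)) (1 + x) ^ (α + 4)`.
It follows from `ψ(z) ≤ exp (2 √z) / Γ(α)`, which holds since `α ≥ 1 / 2`, and averaging it uses the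
moment of order `α + 4`. Since `0 < α ψ' ≤ ψ`, the derivatives of `q` and the flux cost polynomial
factors only, and `|log (g / γ)|` grows at most linearly (`exists_abs_logRatio_le`), so three
polynomial factors suffice for differentiating under the integrals, for the integrability of
both integrands, and for the boundary terms.
-/

namespace GammaSmartPath

open Filter Topology

/-! ### An entire function related to the Bessel functions -/

/-- The regularized confluent limit function `₀F₁(; a; z) / Γ(a)`, an entire function of `z` when
`a > 0`. Its derivative is the same function with `a + 1` in place of `a`. -/
noncomputable def besselClifford (a z : ℝ) : ℝ :=
  ∑' k : ℕ, z ^ k / ((k.factorial : ℝ) * Real.Gamma (a + k))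

lemma Gamma_mul_pow_le {a : ℝ} (ha : 0 < a) (k : ℕ) :
    Real.Gamma a * a ^ k ≤ Real.Gamma (a + k) := by
  induction k with
  | zero => simp
  | succ k ih =>
    have hk : (0 : ℝ) ≤ k := k.cast_nonneg
    have h : Real.Gamma (a + (k + 1 : ℕ)) = (a + k) * Real.Gamma (a + k) := by
      rw [← Real.Gamma_add_one (by positivity)]; push_cast; ring_nf
    rw [h, pow_succ]
    have hG : 0 < Real.Gamma (a + k) := Real.Gamma_pos_of_pos (by positivity)
    nlinarith [mul_le_mul_of_nonneg_right ih ha.le, mul_nonneg hk hG.le]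

lemma besselClifford_term_norm_le {a : ℝ} (ha : 0 < a) (z : ℝ) (k : ℕ) :
    ‖z ^ k / ((k.factorial : ℝ) * Real.Gamma (a + k))‖ ≤
      (|z| / a) ^ k / k.factorial * (Real.Gamma a)⁻¹ := by
  have hG := Real.Gamma_pos_of_pos ha
  have h := Gamma_mul_pow_le ha k
  have hf : (0 : ℝ) < k.factorial := by exact_mod_cast k.factorial_pos
  have hGk : 0 < Real.Gamma (a + k) := Real.Gamma_pos_of_pos (by positivity)
  rw [norm_div, norm_pow, Real.norm_eq_abs, Real.norm_of_nonneg (by positivity), div_pow]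
  calc |z| ^ k / (k.factorial * Real.Gamma (a + k))
      ≤ |z| ^ k / (k.factorial * (Real.Gamma a * a ^ k)) := by gcongr
    _ = _ := by field_simp

lemma summable_besselClifford {a : ℝ} (ha : 0 < a) (z : ℝ) :
    Summable fun k : ℕ => z ^ k / ((k.factorial : ℝ) * Real.Gamma (a + k)) :=
  .of_norm_bounded ((Real.summable_pow_div_factorial (|z| / a)).mul_right _)
    (besselClifford_term_norm_le ha z)

lemma hasDerivAt_besselClifford {a : ℝ} (ha : 0 < a) (z : ℝ) :
    HasDerivAt (besselClifford a) (besselClifford (a + 1) z) z := by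
  have hshift : ∀ (y : ℝ) (k : ℕ), ((k + 1 : ℕ) : ℝ) * y ^ (k + 1 - 1) /
      (((k + 1).factorial : ℝ) * Real.Gamma (a + (k + 1 : ℕ))) =
      y ^ k / ((k.factorial : ℝ) * Real.Gamma (a + 1 + k)) := by
    intro y k
    have e : a + ((k + 1 : ℕ) : ℝ) = a + 1 + k := by push_cast; ring
    rw [Nat.factorial_succ, e]
    push_cast
    have : (k : ℝ) + 1 ≠ 0 := by positivity
    rw [mul_assoc, mul_div_mul_left _ _ this]
  set u : ℕ → ℝ := fun k => ‖(k : ℝ) * (|z| + 1) ^ (k - 1) /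
      ((k.factorial : ℝ) * Real.Gamma (a + k))‖ with hu
  have hus : Summable u := by
    rw [← summable_nat_add_iff 1]
    simp only [hu]
    simp_rw [hshift]
    exact (summable_besselClifford (by positivity) _).norm
  have key := hasDerivAt_tsum_of_isPreconnected (𝕜 := ℝ) (F := ℝ)
    (g := fun (k : ℕ) (y : ℝ) => y ^ k / ((k.factorial : ℝ) * Real.Gamma (a + k)))
    (g' := fun (k : ℕ) (y : ℝ) => (k : ℝ) * y ^ (k - 1) /
      ((k.factorial : ℝ) * Real.Gamma (a + k)))
    (t := Metric.ball 0 (|z| + 1)) (y₀ := z) (y := z) hus Metric.isOpen_ball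
    (convex_ball _ _).isPreconnected
    (fun k y _ => (hasDerivAt_pow k y).div_const _)
    (fun k y hy => by
      have hy' : |y| ≤ |z| + 1 := by simpa using (Metric.mem_ball.1 hy).le
      simp only [hu, norm_div, norm_mul, norm_pow, Real.norm_eq_abs]
      have := pow_le_pow_left₀ (abs_nonneg y) (hy'.trans (le_abs_self _)) (k - 1)
      exact div_le_div_of_nonneg_right (mul_le_mul_of_nonneg_left this (abs_nonneg _))
        (by positivity))
    (by simp) (summable_besselClifford ha z) (by simp)
  have hs : Summable fun k : ℕ => (k : ℝ) * z ^ (k - 1) /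
      ((k.factorial : ℝ) * Real.Gamma (a + k)) := by
    rw [← summable_nat_add_iff 1]
    simp_rw [hshift]
    exact summable_besselClifford (by positivity) _
  rw [hs.tsum_eq_zero_add] at key
  simp_rw [hshift] at key
  simp only [Nat.cast_zero, zero_mul, zero_div, zero_add] at key
  exact key

lemma continuous_besselClifford {a : ℝ} (ha : 0 < a) : Continuous (besselClifford a) :=
  continuous_iff_continuousAt.2 fun z => (hasDerivAt_besselClifford ha z).continuousAt

/-- The differential equation `z ψ'' + a ψ' = ψ`, in terms of contiguous functions. -/
lemma besselClifford_recurrence {a : ℝ} (ha : 0 < a) (z : ℝ) :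
    besselClifford a z = a * besselClifford (a + 1) z + z * besselClifford (a + 2) z := by
  have h1 := summable_besselClifford (a := a + 1) (by positivity) z
  have h2 := summable_besselClifford (a := a + 2) (by positivity) z
  have h0 : ∀ k : ℕ, z ^ k / ((k.factorial : ℝ) * Real.Gamma (a + k)) =
      a * (z ^ k / ((k.factorial : ℝ) * Real.Gamma (a + 1 + k))) +
        k * (z ^ k / ((k.factorial : ℝ) * Real.Gamma (a + 1 + k))) := by
    intro k
    have hak : 0 < a + k := by positivity
    have e : a + 1 + (k : ℝ) = a + k + 1 := by ring
    have hG := Real.Gamma_pos_of_pos hak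
    rw [e, Real.Gamma_add_one hak.ne']
    field_simp
  have hshift : ∀ k : ℕ, ((k + 1 : ℕ) : ℝ) *
      (z ^ (k + 1) / (((k + 1).factorial : ℝ) * Real.Gamma (a + 1 + (k + 1 : ℕ)))) =
      z * (z ^ k / ((k.factorial : ℝ) * Real.Gamma (a + 2 + k))) := by
    intro k
    have e : a + 1 + ((k + 1 : ℕ) : ℝ) = a + 2 + k := by push_cast; ring
    have hG : 0 < Real.Gamma (a + 2 + k) := Real.Gamma_pos_of_pos (by positivity)
    rw [e, Nat.factorial_succ, pow_succ]
    push_cast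
    field_simp
  have hs : Summable fun k : ℕ =>
      (k : ℝ) * (z ^ k / ((k.factorial : ℝ) * Real.Gamma (a + 1 + k))) := by
    rw [← summable_nat_add_iff 1]
    simp_rw [hshift]
    exact h2.mul_left z
  simp only [besselClifford]
  rw [tsum_congr h0, (h1.mul_left a).tsum_add hs, tsum_mul_left, hs.tsum_eq_zero_add]
  simp_rw [hshift]
  rw [tsum_mul_left]
  simp

lemma inv_Gamma_le_besselClifford {a z : ℝ} (ha : 0 < a) (hz : 0 ≤ z) :
    (Real.Gamma a)⁻¹ ≤ besselClifford a z := by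
  have h := (summable_besselClifford ha z).le_tsum 0 fun k _ => by
    have : 0 < Real.Gamma (a + k) := Real.Gamma_pos_of_pos (by positivity)
    positivity
  simpa [besselClifford] using h

lemma besselClifford_pos {a z : ℝ} (ha : 0 < a) (hz : 0 ≤ z) : 0 < besselClifford a z :=
  (inv_pos.2 (Real.Gamma_pos_of_pos ha)).trans_le (inv_Gamma_le_besselClifford ha hz)

lemma mul_besselClifford_add_one_le {a z : ℝ} (ha : 0 < a) (hz : 0 ≤ z) :
    a * besselClifford (a + 1) z ≤ besselClifford a z := by
  rw [besselClifford_recurrence ha z]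
  have := besselClifford_pos (a := a + 2) (by positivity) hz
  nlinarith [mul_nonneg hz this.le]

/-- For `a ≥ 1 / 2` the coefficients of `Γ(a) ψ(w²)` are at most those of `cosh (2 w)`, which is
the case `a = 1 / 2`. -/
lemma besselClifford_le_exp {a z : ℝ} (ha : 1 / 2 ≤ a) (hz : 0 ≤ z) :
    besselClifford a z ≤ (Real.Gamma a)⁻¹ * Real.exp (2 * √z) := by
  have ha0 : 0 < a := by linarith
  have hG := Real.Gamma_pos_of_pos ha0
  have hcoef : ∀ k : ℕ, Real.Gamma a * (2 * k).factorial ≤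
      4 ^ k * ((k.factorial : ℝ) * Real.Gamma (a + k)) := by
    intro k
    induction k with
    | zero => simp
    | succ k ih =>
      have h : Real.Gamma (a + (k + 1 : ℕ)) = (a + k) * Real.Gamma (a + k) := by
        rw [← Real.Gamma_add_one (by positivity)]; push_cast; ring_nf
      have e : 2 * (k + 1) = 2 * k + 1 + 1 := by ring
      have hGk : 0 < Real.Gamma (a + k) := Real.Gamma_pos_of_pos (by positivity)
      rw [h, e, Nat.factorial_succ, Nat.factorial_succ, Nat.factorial_succ]
      push_cast
      have hk : (0 : ℝ) ≤ k := k.cast_nonneg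
      have hf : (0 : ℝ) < k.factorial := by exact_mod_cast k.factorial_pos
      calc Real.Gamma a * ((2 * k + 1 + 1) * ((2 * k + 1) * (2 * k).factorial))
          = (2 * k + 1 + 1) * (2 * k + 1) * (Real.Gamma a * (2 * k).factorial) := by ring
        _ ≤ (2 * k + 1 + 1) * (2 * k + 1) *
            (4 ^ k * ((k.factorial : ℝ) * Real.Gamma (a + k))) := by gcongr
        _ ≤ (2 * k + 1 + 1) * (2 * (a + k)) *
            (4 ^ k * ((k.factorial : ℝ) * Real.Gamma (a + k))) := by gcongr; linarith
        _ = _ := by ring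
  have hsum := (Real.hasSum_cosh (2 * √z)).mul_left (Real.Gamma a)⁻¹
  have hle : besselClifford a z ≤ (Real.Gamma a)⁻¹ * Real.cosh (2 * √z) := by
    rw [← hsum.tsum_eq, besselClifford]
    refine (summable_besselClifford ha0 z).tsum_le_tsum (fun k => ?_) hsum.summable
    have hGk : 0 < Real.Gamma (a + k) := Real.Gamma_pos_of_pos (by positivity)
    have hf : (0 : ℝ) < k.factorial := by exact_mod_cast k.factorial_pos
    have hf2 : (0 : ℝ) < (2 * k).factorial := by exact_mod_cast (2 * k).factorial_pos
    have e : (2 * √z) ^ (2 * k) = 4 ^ k * z ^ k := by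
      rw [pow_mul, mul_pow, Real.sq_sqrt hz, mul_pow]; norm_num
    rw [e, ← div_eq_inv_mul, div_div, div_le_div_iff₀ (by positivity) (by positivity)]
    calc z ^ k * ((2 * k).factorial * Real.Gamma a)
        = z ^ k * (Real.Gamma a * (2 * k).factorial) := by ring
      _ ≤ z ^ k * (4 ^ k * ((k.factorial : ℝ) * Real.Gamma (a + k))) := 
          mul_le_mul_of_nonneg_left (hcoef k) (by positivity)
      _ = _ := by ring
  refine hle.trans ?_
  gcongr
  rw [Real.cosh_eq]
  have : Real.exp (-(2 * √z)) ≤ Real.exp (2 * √z) :=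
    Real.exp_le_exp.2 (by linarith [Real.sqrt_nonneg z])
  linarith

/-- The Bessel function `I_ν` at `2 √z` is `z ^ (ν / 2)` times an entire function of `z`. -/
lemma besselI_eq_besselClifford {α z : ℝ} (hz : 0 < z) :
    besselI (α - 1) (2 * √z) = z ^ ((α - 1) / 2) * besselClifford α z := by
  rw [besselI, besselClifford, ← tsum_mul_left]
  refine tsum_congr fun n => ?_
  have e1 : (2 * √z / 2) ^ (2 * (n : ℝ) + (α - 1)) = z ^ ((α - 1) / 2) * z ^ n := by
    rw [mul_div_cancel_left₀ _ (two_ne_zero), Real.sqrt_eq_rpow, ← Real.rpow_mul hz.le,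
      ← Real.rpow_natCast z n, ← Real.rpow_add hz]
    congr 1; ring
  have e2 : (n : ℝ) + (α - 1) + 1 = α + n := by ring
  rw [e1, e2, mul_div_assoc]

/-! ### The transition density and its domination -/

/-- The factor of `pathKernel` other than the Bessel function. -/
noncomputable def pathWeight (α lam c u x : ℝ) : ℝ :=
  c ^ α * u ^ (α - 1) * Real.exp (-(c * u) - (c - lam) * x)

/-- The density at `u` of the smart path started from the point `x`, in terms of the parameter
`c = lam / (1 - τ)`: the Poisson mixture of the gamma densities of shape `α + k` and rate `c`,
where `k` has parameter `(c - lam) * x`. -/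
noncomputable def pathKernel (α lam c u x : ℝ) : ℝ :=
  pathWeight α lam c u x * besselClifford α (c * (c - lam) * u * x)

/-- The derivative of `pathKernel` in `c`. -/
noncomputable def pathKernelDeriv (α lam c u x : ℝ) : ℝ :=
  pathWeight α lam c u x * ((α / c - u - x) * besselClifford α (c * (c - lam) * u * x) +
    (2 * c - lam) * u * x * besselClifford (α + 1) (c * (c - lam) * u * x))

/-- The flux `u (∂q/∂u - gammaScore * q)` of the kernel `q = pathKernel`. -/
noncomputable def pathFlux (α lam c u x : ℝ) : ℝ :=
  pathWeight α lam c u x * (-((c - lam) * u) * besselClifford α (c * (c - lam) * u * x) +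
    c * (c - lam) * u * x * besselClifford (α + 1) (c * (c - lam) * u * x))

section Derivatives

variable {α lam c u x : ℝ}

lemma hasDerivAt_pathWeight_rate (hc : 0 < c) :
    HasDerivAt (fun s => pathWeight α lam s u x)
      (pathWeight α lam c u x * (α / c - u - x)) c := by
  have h1 := (Real.hasDerivAt_rpow_const (x := c) (p := α) (Or.inl hc.ne')).mul_const
    (u ^ (α - 1))
  have h2 : HasDerivAt (fun s : ℝ => -(s * u) - (s - lam) * x) (-(1 * u) - 1 * x) c :=
    ((hasDerivAt_id c).mul_const u).neg.sub (((hasDerivAt_id c).sub_const lam).mul_const x)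
  refine (h1.mul h2.exp).congr_deriv ?_
  rw [pathWeight, Real.rpow_sub_one hc.ne']
  field_simp
  ring

lemma hasDerivAt_pathWeight (hu : 0 < u) :
    HasDerivAt (fun v => pathWeight α lam c v x)
      (pathWeight α lam c u x * ((α - 1) / u - c)) u := by
  have h1 := (Real.hasDerivAt_rpow_const (x := u) (p := α - 1) (Or.inl hu.ne')).const_mul (c ^ α)
  have h2 : HasDerivAt (fun v : ℝ => -(c * v) - (c - lam) * x) (-(c * 1)) u :=
    ((hasDerivAt_id u).const_mul c).neg.sub_const _
  refine (h1.mul h2.exp).congr_deriv ?_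
  rw [pathWeight, Real.rpow_sub_one hu.ne' (α - 1)]
  field_simp
  ring

lemma hasDerivAt_besselClifford_comp {a : ℝ} (ha : 0 < a) (u : ℝ) :
    HasDerivAt (fun v => besselClifford a (c * (c - lam) * v * x))
      (besselClifford (a + 1) (c * (c - lam) * u * x) * (c * (c - lam) * x)) u := by
  have h : HasDerivAt (fun v : ℝ => c * (c - lam) * v * x) (c * (c - lam) * 1 * x) u :=
    ((hasDerivAt_id u).const_mul _).mul_const x
  refine ((hasDerivAt_besselClifford ha _).comp u h).congr_deriv ?_
  ring

lemma hasDerivAt_pathKernel_rate (hα : 0 < α) (hc : 0 < c) :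
    HasDerivAt (fun s => pathKernel α lam s u x) (pathKernelDeriv α lam c u x) c := by
  have h : HasDerivAt (fun s : ℝ => s * (s - lam) * u * x) ((1 * (c - lam) + c * 1) * u * x) c :=
    ((((hasDerivAt_id c).mul ((hasDerivAt_id c).sub_const lam))).mul_const u).mul_const x
  refine ((hasDerivAt_pathWeight_rate hc).mul
    ((hasDerivAt_besselClifford hα _).comp c h)).congr_deriv ?_
  simp only [pathKernelDeriv, Function.comp]
  ring

lemma hasDerivAt_pathKernel (hα : 0 < α) (hu : 0 < u) :
    HasDerivAt (fun v => pathKernel α lam c v x)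
      (gammaScore α lam u * pathKernel α lam c u x + pathFlux α lam c u x / u) u := by
  refine ((hasDerivAt_pathWeight hu).mul (hasDerivAt_besselClifford_comp hα u)).congr_deriv ?_
  simp only [pathKernel, pathFlux, gammaScore]
  field_simp
  ring

/-- The evolution equation of the kernel in conservative form: the Bessel differential equation
turns the `u`-derivative of the flux into the `c`-derivative of the kernel. -/
lemma hasDerivAt_pathFlux (hα : 0 < α) (hc : 0 < c) (hu : 0 < u) :
    HasDerivAt (fun v => pathFlux α lam c v x)
      (-(c * (c - lam)) * pathKernelDeriv α lam c u x) u := by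
  have h1 : HasDerivAt (fun v : ℝ => -((c - lam) * v)) (-((c - lam) * 1)) u :=
    ((hasDerivAt_id u).const_mul _).neg
  have h2 : HasDerivAt (fun v : ℝ => c * (c - lam) * v * x) (c * (c - lam) * 1 * x) u :=
    ((hasDerivAt_id u).const_mul _).mul_const x
  refine ((hasDerivAt_pathWeight hu).mul ((h1.mul (hasDerivAt_besselClifford_comp hα u)).add
    (h2.mul (hasDerivAt_besselClifford_comp (by positivity) u)))).congr_deriv ?_
  have hrec := besselClifford_recurrence hα (c * (c - lam) * u * x)
  have e : α + 1 + 1 = α + 2 := by ring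
  simp only [pathKernelDeriv, Pi.add_apply, Pi.mul_apply, e]
  generalize besselClifford α (c * (c - lam) * u * x) = ψ₀ at *
  generalize besselClifford (α + 1) (c * (c - lam) * u * x) = ψ₁ at *
  generalize besselClifford (α + 2) (c * (c - lam) * u * x) = ψ₂ at *
  field_simp
  linear_combination (-(c * (c - lam) * x) * pathWeight α lam c u x) * hrec

end Derivatives

section Bounds

variable {α lam c u x M : ℝ}

lemma pathWeight_pos (hc : 0 < c) (hu : 0 < u) : 0 < pathWeight α lam c u x := by
  unfold pathWeight; positivity

lemma pathKernel_pos (hα : 0 < α) (hlam : 0 < lam) (hc : lam ≤ c) (hu : 0 < u) (hx : 0 ≤ x) :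
    0 < pathKernel α lam c u x := by
  have hc0 : 0 < c := hlam.trans_le hc
  have hr : 0 ≤ c - lam := by linarith
  exact mul_pos (pathWeight_pos hc0 hu) (besselClifford_pos hα (by positivity))

lemma le_pathKernel (hα : 0 < α) (hlam : 0 < lam) (hc : lam ≤ c) (hcM : c ≤ M) (hu : 0 < u)
    (hx : 0 ≤ x) :
    lam ^ α * (Real.Gamma α)⁻¹ * u ^ (α - 1) * Real.exp (-(M * u)) * Real.exp (-(M * x)) ≤
      pathKernel α lam c u x := by
  have hc0 : 0 < c := hlam.trans_le hc
  have hr : 0 ≤ c - lam := by linarith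
  have hG := Real.Gamma_pos_of_pos hα
  have h1 := inv_Gamma_le_besselClifford hα (z := c * (c - lam) * u * x) (by positivity)
  have h2 : Real.exp (-(M * u)) * Real.exp (-(M * x)) ≤
      Real.exp (-(c * u) - (c - lam) * x) := by
    rw [← Real.exp_add, Real.exp_le_exp]
    nlinarith
  calc _ = lam ^ α * u ^ (α - 1) * (Real.exp (-(M * u)) * Real.exp (-(M * x))) *
        (Real.Gamma α)⁻¹ := by ring
    _ ≤ c ^ α * u ^ (α - 1) * Real.exp (-(c * u) - (c - lam) * x) *
        besselClifford α (c * (c - lam) * u * x) := by gcongr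
    _ = _ := rfl

/-- The Gaussian-type bound on the kernel. The Bessel function is at most
`exp (2 √(c (c - lam) u x))`, which completes the square in the exponent. -/
lemma pathKernel_le_exp (hα : 1 / 2 ≤ α) (hlam : 0 < lam) (hc : lam ≤ c) (hu : 0 < u)
    (hx : 0 ≤ x) :
    pathKernel α lam c u x ≤ c ^ α * (Real.Gamma α)⁻¹ * u ^ (α - 1) *
      Real.exp (-(√(c * u) - √((c - lam) * x)) ^ 2) := by
  have hc0 : 0 < c := hlam.trans_le hc
  have hr : 0 ≤ c - lam := by linarith
  have h1 := besselClifford_le_exp hα (z := c * (c - lam) * u * x) (by positivity)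
  have e : c * (c - lam) * u * x = (c * u) * ((c - lam) * x) := by ring
  have h3 : Real.exp (-(√(c * u) - √((c - lam) * x)) ^ 2) =
      Real.exp (-(c * u) - (c - lam) * x) * Real.exp (2 * √(c * (c - lam) * u * x)) := by
    rw [← Real.exp_add, e, Real.sqrt_mul (show 0 ≤ c * u by positivity) ((c - lam) * x)]
    congr 1
    have h1 := Real.sq_sqrt (x := c * u) (by positivity)
    have h2 := Real.sq_sqrt (x := (c - lam) * x) (by positivity)
    linear_combination -h1 - h2
  rw [h3, pathKernel, pathWeight]
  calc _ ≤ c ^ α * u ^ (α - 1) * Real.exp (-(c * u) - (c - lam) * x) *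
        ((Real.Gamma α)⁻¹ * Real.exp (2 * √(c * (c - lam) * u * x))) := by gcongr
    _ = _ := by ring

lemma pathKernel_le (hα : 1 / 2 ≤ α) (hlam : 0 < lam) (hc : lam ≤ c) (hcM : c ≤ M) (hu : 0 < u)
    (hx : 0 ≤ x) :
    pathKernel α lam c u x ≤ M ^ α * (Real.Gamma α)⁻¹ * u ^ (α - 1) := by
  have hc0 : 0 < c := hlam.trans_le hc
  have hG := Real.Gamma_pos_of_pos (show 0 < α by linarith)
  refine (pathKernel_le_exp hα hlam hc hu hx).trans ?_
  have hM0 : 0 < M := hc0.trans_le hcM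
  have h : Real.exp (-(√(c * u) - √((c - lam) * x)) ^ 2) ≤ 1 := by
    rw [Real.exp_le_one_iff]
    nlinarith [sq_nonneg (√(c * u) - √((c - lam) * x))]
  calc _ ≤ M ^ α * (Real.Gamma α)⁻¹ * u ^ (α - 1) * 1 := by gcongr
    _ = _ := mul_one _

lemma exists_rpow_mul_exp_le {b : ℝ} (hb : 0 < b) (p : ℝ) :
    ∃ C, 0 < C ∧ ∀ u, 0 < u → (1 + u) ^ p * Real.exp (-(b * u)) ≤ C := by
  have ht := tendsto_rpow_mul_exp_neg_mul_atTop_nhds_zero p b hb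
  have hcont : ContinuousOn (fun y : ℝ => y ^ p * Real.exp (-b * y)) (Ici 1) := by
    intro y hy
    have : y ≠ 0 := (zero_lt_one.trans_le hy).ne'
    exact ((Real.continuousAt_rpow_const y p (Or.inl this)).mul
      (by fun_prop)).continuousWithinAt
  obtain ⟨N, hN⟩ := Filter.eventually_atTop.1 (ht.eventually (gt_mem_nhds zero_lt_one))
  obtain ⟨B, hB⟩ := (isCompact_Icc (a := (1 : ℝ)) (b := N)).bddAbove_image
    (hcont.mono Icc_subset_Ici_self)
  refine ⟨max 1 B * Real.exp b, by positivity, fun u hu => ?_⟩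
  have h : (1 + u) ^ p * Real.exp (-b * (1 + u)) ≤ max 1 B := by
    rcases le_total (1 + u) N with h | h
    · exact (hB ⟨1 + u, ⟨by linarith, h⟩, rfl⟩).trans (le_max_right _ _)
    · exact (hN _ h).le.trans (le_max_left _ _)
  calc (1 + u) ^ p * Real.exp (-(b * u))
      = (1 + u) ^ p * Real.exp (-b * (1 + u)) * Real.exp b := by
        rw [mul_assoc, ← Real.exp_add]; ring_nf
    _ ≤ _ := by gcongr

/-- Domination of the kernel with three polynomial factors by a product, uniformly for `c` in
`[lam, M]`. Where `u ≤ 4 x`, powers of `u` are traded for powers of `x`; where `4 x < u`, the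
kernel decays exponentially in `u`. -/
lemma exists_pathKernel_mul_le (hα : 1 / 2 ≤ α) (hlam : 0 < lam) (hM : lam ≤ M) :
    ∃ C, 0 < C ∧ ∀ c, lam ≤ c → c ≤ M → ∀ u, 0 < u → ∀ x, 0 < x →
      pathKernel α lam c u x * (1 + u + x) ^ 3 ≤
        C * (u ^ (α - 1) * (1 + u) ^ (-(α + 1))) * (1 + x) ^ (α + 4) := by
  have hα0 : 0 < α := by linarith
  have hG := Real.Gamma_pos_of_pos hα0
  have hM0 : 0 < M := hlam.trans_le hM
  obtain ⟨C₁, hC₁, hC₁'⟩ := exists_rpow_mul_exp_le (b := lam / 4) (by positivity) (α + 4)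
  set A : ℝ := M ^ α * (Real.Gamma α)⁻¹ with hA
  have hA0 : 0 < A := by positivity
  refine ⟨A * (125 * 4 ^ (α + 1) + 8 * C₁), by positivity, fun c hc hcM u hu x hx => ?_⟩
  have hc0 : 0 < c := hlam.trans_le hc
  have hr : 0 ≤ c - lam := by linarith
  have hu1 : 0 < 1 + u := by linarith
  have hx1 : 0 < 1 + x := by linarith
  have hinv : (1 + u) ^ (α + 1) * (1 + u) ^ (-(α + 1)) = 1 := by
    rw [← Real.rpow_add hu1]; simp
  have hsplit : ∀ y : ℝ, 0 < y → y ^ (α + 4) = y ^ 3 * y ^ (α + 1) := by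
    intro y hy
    rw [← Real.rpow_natCast, ← Real.rpow_add hy]; congr 1; push_cast; ring
  -- It suffices to bound the exponential factor with the powers of `1 + u` on the left.
  have key : ∀ q, pathKernel α lam c u x ≤ A * u ^ (α - 1) * q →
      q * ((1 + u + x) ^ 3 * (1 + u) ^ (α + 1)) ≤
        (125 * 4 ^ (α + 1) + 8 * C₁) * (1 + x) ^ (α + 4) →
      pathKernel α lam c u x * (1 + u + x) ^ 3 ≤
        A * (125 * 4 ^ (α + 1) + 8 * C₁) * (u ^ (α - 1) * (1 + u) ^ (-(α + 1))) *
          (1 + x) ^ (α + 4) := by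
    intro q hq hq'
    calc pathKernel α lam c u x * (1 + u + x) ^ 3
        ≤ A * u ^ (α - 1) * q * (1 + u + x) ^ 3 := by gcongr
      _ = A * u ^ (α - 1) * (1 + u) ^ (-(α + 1)) *
          (q * ((1 + u + x) ^ 3 * (1 + u) ^ (α + 1))) := by
          linear_combination (-(A * u ^ (α - 1) * q * (1 + u + x) ^ 3)) * hinv
      _ ≤ A * u ^ (α - 1) * (1 + u) ^ (-(α + 1)) *
          ((125 * 4 ^ (α + 1) + 8 * C₁) * (1 + x) ^ (α + 4)) := by gcongr
      _ = _ := by ring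
  rcases le_or_gt u (4 * x) with h | h
  · refine key 1 (by simpa [hA] using pathKernel_le hα hlam hc hcM hu hx.le) ?_
    have h1 : (1 + u + x) ^ 3 ≤ 125 * (1 + x) ^ 3 := by
      calc (1 + u + x) ^ 3 ≤ (5 * (1 + x)) ^ 3 := by gcongr; linarith
        _ = _ := by ring
    have h2 : (1 + u) ^ (α + 1) ≤ 4 ^ (α + 1) * (1 + x) ^ (α + 1) := by
      rw [← Real.mul_rpow (by norm_num) hx1.le]
      gcongr
      linarith
    calc 1 * ((1 + u + x) ^ 3 * (1 + u) ^ (α + 1))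
        ≤ 1 * ((125 * (1 + x) ^ 3) * (4 ^ (α + 1) * (1 + x) ^ (α + 1))) := by gcongr
      _ = 125 * 4 ^ (α + 1) * (1 + x) ^ (α + 4) := by rw [hsplit _ hx1]; ring
      _ ≤ _ := by gcongr; linarith
  · refine key (Real.exp (-(lam / 4 * u))) ?_ ?_
    · refine (pathKernel_le_exp hα hlam hc hu hx.le).trans ?_
      have h1 : √((c - lam) * x) ≤ √(c * u) / 2 := by
        rw [Real.sqrt_le_left (by positivity), div_pow, Real.sq_sqrt (by positivity)]
        nlinarith
      have h2 : c * u / 4 ≤ (√(c * u) - √((c - lam) * x)) ^ 2 := by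
        have h3 := Real.sq_sqrt (x := c * u) (by positivity)
        nlinarith [Real.sqrt_nonneg (c * u)]
      rw [hA]
      gcongr
      nlinarith
    · have h1 : (1 + u + x) ^ 3 ≤ 8 * (1 + u) ^ 3 := by
        calc (1 + u + x) ^ 3 ≤ (2 * (1 + u)) ^ 3 := by gcongr; linarith
          _ = _ := by ring
      have h2 : (1 : ℝ) ≤ (1 + x) ^ (α + 4) := Real.one_le_rpow (by linarith) (by linarith)
      calc Real.exp (-(lam / 4 * u)) * ((1 + u + x) ^ 3 * (1 + u) ^ (α + 1))
          ≤ Real.exp (-(lam / 4 * u)) * (8 * (1 + u) ^ 3 * (1 + u) ^ (α + 1)) := by gcongr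
        _ = 8 * ((1 + u) ^ (α + 4) * Real.exp (-(lam / 4 * u))) := by rw [hsplit _ hu1]; ring
        _ ≤ 8 * C₁ * 1 := by rw [mul_one]; gcongr; exact hC₁' u hu
        _ ≤ _ := by gcongr; linarith [show (0:ℝ) < 125 * 4 ^ (α + 1) by positivity]

lemma abs_pathKernelDeriv_le (hα : 0 < α) (hlam : 0 < lam) (hc : lam ≤ c) (hcM : c ≤ M)
    (hu : 0 < u) (hx : 0 < x) :
    |pathKernelDeriv α lam c u x| ≤
      (α / lam + 1 + 2 * M / α) * (pathKernel α lam c u x * (1 + u + x) ^ 2) := by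
  have hc0 : 0 < c := hlam.trans_le hc
  have hr : 0 ≤ c - lam := by linarith
  have hM0 : 0 < M := hc0.trans_le hcM
  have hW := pathWeight_pos (α := α) (lam := lam) (x := x) hc0 hu
  have hz : 0 ≤ c * (c - lam) * u * x := by positivity
  have h0 := besselClifford_pos hα hz
  have h1 := besselClifford_pos (show 0 < α + 1 by positivity) hz
  have h2 : besselClifford (α + 1) (c * (c - lam) * u * x) ≤
      besselClifford α (c * (c - lam) * u * x) / α := by
    rw [le_div_iff₀' hα]; exact mul_besselClifford_add_one_le hα hz
  rw [pathKernelDeriv, pathKernel, abs_mul, abs_of_pos hW]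
  set ψ := besselClifford α (c * (c - lam) * u * x)
  set ψ' := besselClifford (α + 1) (c * (c - lam) * u * x)
  have h3 : |α / c - u - x| ≤ (α / lam + 1) * (1 + u + x) ^ 2 := by
    have h4 : α / c ≤ α / lam := by gcongr
    have h5 : 0 < α / c := by positivity
    have h6 : 1 + u + x ≤ (1 + u + x) ^ 2 := by nlinarith
    have h7 : 0 < α / lam := by positivity
    rw [abs_le]
    constructor <;> nlinarith
  have h4 : (2 * c - lam) * u * x * ψ' ≤ 2 * M / α * (1 + u + x) ^ 2 * ψ := by
    have h5 : u * x ≤ (1 + u + x) ^ 2 := by nlinarith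
    calc (2 * c - lam) * u * x * ψ' ≤ (2 * M) * (u * x) * (ψ / α) := by
          rw [mul_assoc (2 * c - lam)]; gcongr; linarith
      _ ≤ (2 * M) * (1 + u + x) ^ 2 * (ψ / α) := by gcongr
      _ = _ := by ring
  have h5 : 0 ≤ (2 * c - lam) * u * x * ψ' := by
    have : 0 ≤ 2 * c - lam := by linarith
    positivity
  calc _ ≤ pathWeight α lam c u x * (|(α / c - u - x) * ψ| + |(2 * c - lam) * u * x * ψ'|) := by
        gcongr; exact abs_add_le _ _
    _ ≤ pathWeight α lam c u x * ((α / lam + 1) * (1 + u + x) ^ 2 * ψ +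
        2 * M / α * (1 + u + x) ^ 2 * ψ) := by
        rw [abs_mul, abs_of_pos h0, abs_of_nonneg h5]; gcongr
    _ = _ := by ring

lemma abs_pathFlux_le (hα : 0 < α) (hlam : 0 < lam) (hc : lam ≤ c) (hcM : c ≤ M)
    (hu : 0 < u) (hx : 0 < x) :
    |pathFlux α lam c u x| ≤ (M + M ^ 2 / α) * (u * (pathKernel α lam c u x * (1 + x))) := by
  have hc0 : 0 < c := hlam.trans_le hc
  have hr : 0 ≤ c - lam := by linarith
  have hM0 : 0 < M := hc0.trans_le hcM
  have hW := pathWeight_pos (α := α) (lam := lam) (x := x) hc0 hu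
  have hz : 0 ≤ c * (c - lam) * u * x := by positivity
  have h0 := besselClifford_pos hα hz
  have h1 := besselClifford_pos (show 0 < α + 1 by positivity) hz
  have h2 : besselClifford (α + 1) (c * (c - lam) * u * x) ≤
      besselClifford α (c * (c - lam) * u * x) / α := by
    rw [le_div_iff₀' hα]; exact mul_besselClifford_add_one_le hα hz
  rw [pathFlux, pathKernel, abs_mul, abs_of_pos hW]
  have h5 : 0 ≤ c * (c - lam) * u * x * besselClifford (α + 1) (c * (c - lam) * u * x) := by
    positivity
  have h6 : c * (c - lam) ≤ M ^ 2 := by nlinarith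
  set ψ := besselClifford α (c * (c - lam) * u * x)
  set ψ' := besselClifford (α + 1) (c * (c - lam) * u * x)
  calc _ ≤ pathWeight α lam c u x * (|-((c - lam) * u) * ψ| + |c * (c - lam) * u * x * ψ'|) := by
        gcongr; exact abs_add_le _ _
    _ ≤ pathWeight α lam c u x * (M * u * ψ + M ^ 2 * u * x * (ψ / α)) := by
        rw [abs_mul, abs_neg, abs_of_pos h0, abs_of_nonneg h5, abs_of_nonneg (by positivity)]
        gcongr
        linarith
    _ ≤ pathWeight α lam c u x * (M * u * ψ * (1 + x) + M ^ 2 * u * (1 + x) * (ψ / α)) := by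
        have h7 : M * u * ψ ≤ M * u * ψ * (1 + x) :=
          le_mul_of_one_le_right (by positivity) (by linarith)
        have h8 : M ^ 2 * u * x * (ψ / α) ≤ M ^ 2 * u * (1 + x) * (ψ / α) := by
          gcongr
          linarith
        gcongr
    _ = _ := by ring

end Bounds

/-! ### Averages over the law of the starting point -/

/-- The function of `u` that dominates the smart path density, with polynomial factors. -/
noncomputable def envelope (α u : ℝ) : ℝ := u ^ (α - 1) * (1 + u) ^ (-(α + 1))

lemma envelope_nonneg (α : ℝ) {u : ℝ} (hu : 0 < u) : 0 ≤ envelope α u := by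
  unfold envelope; positivity

lemma continuousAt_envelope (α : ℝ) {u : ℝ} (hu : 0 < u) : ContinuousAt (envelope α) u := by
  have h1 : ContinuousAt (fun v : ℝ => 1 + v) u := by fun_prop
  exact (Real.continuousAt_rpow_const _ _ (Or.inl hu.ne')).mul
    (h1.rpow_const (Or.inl (by positivity)))

lemma integrableOn_envelope {α : ℝ} (hα : 0 < α) : IntegrableOn (envelope α) (Ioi 0) := by
  have hm : ∀ s ⊆ Ioi (0 : ℝ), MeasurableSet s →
      AEStronglyMeasurable (envelope α) (volume.restrict s) := fun s hs hsm =>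
    (ContinuousOn.aestronglyMeasurable
      (fun u hu => (continuousAt_envelope α (hs hu)).continuousWithinAt) hsm)
  rw [← Ioc_union_Ioi_eq_Ioi (zero_le_one (α := ℝ))]
  refine IntegrableOn.union ?_ ?_
  · have h := (intervalIntegrable_iff_integrableOn_Ioc_of_le zero_le_one).1
      (intervalIntegral.intervalIntegrable_rpow' (a := 0) (b := 1) (show -1 < α - 1 by linarith))
    refine Integrable.mono' h (hm _ (fun u hu => hu.1) measurableSet_Ioc) ?_
    refine (ae_restrict_iff' measurableSet_Ioc).2 (ae_of_all _ fun u hu => ?_)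
    rw [Real.norm_of_nonneg (envelope_nonneg α hu.1)]
    have hu0 : 0 < u := hu.1
    exact mul_le_of_le_one_right (by positivity)
      (Real.rpow_le_one_of_one_le_of_nonpos (by linarith) (by linarith))
  · refine Integrable.mono' (integrableOn_Ioi_rpow_of_lt (show (-2 : ℝ) < -1 by norm_num)
      zero_lt_one) (hm _ (Ioi_subset_Ioi zero_le_one) measurableSet_Ioi) ?_
    refine (ae_restrict_iff' measurableSet_Ioi).2 (ae_of_all _ fun u hu => ?_)
    have hu0 : 0 < u := zero_lt_one.trans hu
    rw [Real.norm_of_nonneg (envelope_nonneg α hu0)]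
    calc envelope α u ≤ u ^ (α - 1) * u ^ (-(α + 1)) :=
          mul_le_mul_of_nonneg_left
            (Real.rpow_le_rpow_of_nonpos hu0 (by linarith) (by linarith)) (by positivity)
      _ = u ^ (-2 : ℝ) := by rw [← Real.rpow_add hu0]; congr 1; ring

lemma mul_envelope_le {α u : ℝ} (hα : 0 < α) (hu : 0 < u) :
    u * envelope α u ≤ u ^ α ∧ u * envelope α u ≤ u⁻¹ := by
  have e : u * envelope α u = u ^ α * (1 + u) ^ (-(α + 1)) := by
    rw [envelope, Real.rpow_sub_one hu.ne']; field_simp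
  rw [e]
  refine ⟨mul_le_of_le_one_right (by positivity)
    (Real.rpow_le_one_of_one_le_of_nonpos (by linarith) (by linarith)), ?_⟩
  calc u ^ α * (1 + u) ^ (-(α + 1)) ≤ u ^ α * u ^ (-(α + 1)) :=
        mul_le_mul_of_nonneg_left
          (Real.rpow_le_rpow_of_nonpos hu (by linarith) (by linarith)) (by positivity)
    _ = u⁻¹ := by rw [← Real.rpow_add hu, ← Real.rpow_neg_one]; congr 1; ring

lemma tendsto_mul_envelope_zero {α : ℝ} (hα : 0 < α) :
    Tendsto (fun u => u * envelope α u) (𝓝[>] 0) (𝓝 0) := by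
  have h : Tendsto (fun u : ℝ => u ^ α) (𝓝[>] 0) (𝓝 0) := by
    have := (Real.continuousAt_rpow_const 0 α (Or.inr hα.le)).tendsto
    rw [Real.zero_rpow hα.ne'] at this
    exact this.mono_left nhdsWithin_le_nhds
  refine tendsto_of_tendsto_of_tendsto_of_le_of_le' tendsto_const_nhds h ?_ ?_
  · filter_upwards [self_mem_nhdsWithin] with u hu
    exact mul_nonneg (le_of_lt hu) (envelope_nonneg α hu)
  · filter_upwards [self_mem_nhdsWithin] with u hu
    exact (mul_envelope_le hα hu).1

lemma tendsto_mul_envelope_atTop {α : ℝ} (hα : 0 < α) :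
    Tendsto (fun u => u * envelope α u) atTop (𝓝 0) := by
  refine tendsto_of_tendsto_of_tendsto_of_le_of_le' tendsto_const_nhds tendsto_inv_atTop_zero ?_ ?_
  · filter_upwards [eventually_gt_atTop 0] with u hu
    exact mul_nonneg (le_of_lt hu) (envelope_nonneg α hu)
  · filter_upwards [eventually_gt_atTop 0] with u hu
    exact (mul_envelope_le hα hu).2

/-- The density at `u` of the smart path, with `c = lam / (1 - τ)`, where `μ` is the law of `X`. -/
noncomputable def mixDensity (α lam : ℝ) (μ : Measure ℝ) (c u : ℝ) : ℝ :=
  ∫ x, pathKernel α lam c u x ∂μ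

/-- The derivative of `mixDensity` in `c`. -/
noncomputable def mixDensityDeriv (α lam : ℝ) (μ : Measure ℝ) (c u : ℝ) : ℝ :=
  ∫ x, pathKernelDeriv α lam c u x ∂μ

/-- The flux `u (∂g/∂u - gammaScore * g)` of the density `g = mixDensity`. -/
noncomputable def mixFlux (α lam : ℝ) (μ : Measure ℝ) (c u : ℝ) : ℝ :=
  ∫ x, pathFlux α lam c u x ∂μ

lemma continuous_pathKernel {α : ℝ} (hα : 0 < α) (lam c u : ℝ) :
    Continuous (pathKernel α lam c u) := by
  have := continuous_besselClifford hα
  unfold pathKernel pathWeight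
  fun_prop

lemma continuous_pathKernelDeriv {α : ℝ} (hα : 0 < α) (lam c u : ℝ) :
    Continuous (pathKernelDeriv α lam c u) := by
  have := continuous_besselClifford hα
  have := continuous_besselClifford (show 0 < α + 1 by positivity)
  unfold pathKernelDeriv pathWeight
  fun_prop

lemma continuous_pathFlux {α : ℝ} (hα : 0 < α) (lam c u : ℝ) :
    Continuous (pathFlux α lam c u) := by
  have := continuous_besselClifford hα
  have := continuous_besselClifford (show 0 < α + 1 by positivity)
  unfold pathFlux pathWeight
  fun_prop

section Mixture

variable {α lam c M u : ℝ} {μ : Measure ℝ}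

lemma integrable_pathKernel_mul (hα : 1 / 2 ≤ α) (hlam : 0 < lam)
    (hpos : ∀ᵐ x ∂μ, 0 < x) (hmom : Integrable (fun x => (1 + x) ^ (α + 4)) μ)
    (hc : lam ≤ c) (hu : 0 < u) :
    Integrable (fun x => pathKernel α lam c u x * (1 + u + x) ^ 3) μ := by
  obtain ⟨C, hC, hC'⟩ := exists_pathKernel_mul_le hα hlam hc
  have := continuous_pathKernel (show 0 < α by linarith) lam c u
  refine Integrable.mono' (hmom.const_mul (C * envelope α u))
    (by fun_prop : Continuous _).aestronglyMeasurable ?_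
  filter_upwards [hpos] with x hx
  have hq := pathKernel_pos (u := u) (x := x) (show 0 < α by linarith) hlam hc hu hx.le
  rw [Real.norm_of_nonneg (by positivity)]
  exact hC' c hc le_rfl u hu x hx

lemma integrable_of_abs_le_pathKernel {f : ℝ → ℝ} (hf : Continuous f) {K : ℝ}
    (hα : 1 / 2 ≤ α) (hlam : 0 < lam)
    (hpos : ∀ᵐ x ∂μ, 0 < x) (hmom : Integrable (fun x => (1 + x) ^ (α + 4)) μ)
    (hc : lam ≤ c) (hu : 0 < u)
    (h : ∀ x, 0 < x → |f x| ≤ K * (pathKernel α lam c u x * (1 + u + x) ^ 3)) :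
    Integrable f μ :=
  ((integrable_pathKernel_mul hα hlam hpos hmom hc hu).const_mul K).mono'
    hf.aestronglyMeasurable (hpos.mono fun x hx => h x hx)

/-- Uniform domination of the mixture of the kernel with three polynomial factors. -/
lemma exists_integral_pathKernel_mul_le (hα : 1 / 2 ≤ α) (hlam : 0 < lam)
    (hpos : ∀ᵐ x ∂μ, 0 < x) (hmom : Integrable (fun x => (1 + x) ^ (α + 4)) μ) (hM : lam ≤ M) :
    ∃ C, 0 ≤ C ∧ ∀ c, lam ≤ c → c ≤ M → ∀ u, 0 < u →
      ∫ x, pathKernel α lam c u x * (1 + u + x) ^ 3 ∂μ ≤ C * envelope α u := by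
  obtain ⟨C, hC, hC'⟩ := exists_pathKernel_mul_le hα hlam hM
  have hS : 0 ≤ ∫ x, (1 + x) ^ (α + 4) ∂μ :=
    integral_nonneg_of_ae (hpos.mono fun x hx => by
      have : 0 < x := hx
      positivity)
  refine ⟨C * ∫ x, (1 + x) ^ (α + 4) ∂μ, by positivity, fun c hc hcM u hu => ?_⟩
  calc _ ≤ ∫ x, C * envelope α u * (1 + x) ^ (α + 4) ∂μ :=
        integral_mono_ae (integrable_pathKernel_mul hα hlam hpos hmom hc hu) (hmom.const_mul _)
          (hpos.mono fun x hx => hC' c hc hcM u hu x hx)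
    _ = _ := by rw [integral_const_mul]; ring

/-- Local domination used to differentiate under the integral in `u`. -/
lemma exists_pathKernel_mul_le_of_near (hα : 1 / 2 ≤ α) (hlam : 0 < lam) (hc : lam ≤ c)
    (hu : 0 < u) :
    ∃ L, ∀ v ∈ Icc (u / 2) (2 * u), ∀ x, 0 < x →
      pathKernel α lam c v x * (1 + v + x) ^ 3 ≤ L * (1 + x) ^ (α + 4) := by
  obtain ⟨C, hC, hC'⟩ := exists_pathKernel_mul_le hα hlam hc
  have hpos : ∀ v ∈ Icc (u / 2) (2 * u), 0 < v := fun v hv => (half_pos hu).trans_le hv.1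
  obtain ⟨B, hB⟩ := (isCompact_Icc (a := u / 2) (b := 2 * u)).bddAbove_image
    (f := envelope α)
    (fun v hv => (continuousAt_envelope α (hpos v hv)).continuousWithinAt)
  refine ⟨C * B, fun v hv x hx => (hC' c hc le_rfl v (hpos v hv) x hx).trans ?_⟩
  have h : envelope α v ≤ B := hB ⟨v, hv, rfl⟩
  have hx1 : 0 < 1 + x := by linarith
  change C * envelope α v * _ ≤ _
  gcongr

lemma pathKernel_mul_le_mul_cube {p x : ℝ} (hα : 0 < α) (hlam : 0 < lam) (hc : lam ≤ c)
    (hu : 0 < u) (hx : 0 < x) (hp : p ≤ (1 + u + x) ^ 3) :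
    pathKernel α lam c u x * p ≤ pathKernel α lam c u x * (1 + u + x) ^ 3 :=
  mul_le_mul_of_nonneg_left hp (pathKernel_pos hα hlam hc hu hx.le).le

lemma one_add_le_cube {u x : ℝ} (hu : 0 < u) (hx : 0 < x) : 1 + x ≤ (1 + u + x) ^ 3 :=
  (by linarith : 1 + x ≤ 1 + u + x).trans (le_self_pow₀ (by linarith) (by norm_num))

lemma integrable_pathKernel (hα : 1 / 2 ≤ α) (hlam : 0 < lam)
    (hpos : ∀ᵐ x ∂μ, 0 < x) (hmom : Integrable (fun x => (1 + x) ^ (α + 4)) μ)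
    (hc : lam ≤ c) (hu : 0 < u) : Integrable (pathKernel α lam c u) μ := by
  have hα0 : 0 < α := by linarith
  refine integrable_of_abs_le_pathKernel (continuous_pathKernel hα0 lam c u) (K := 1) hα hlam hpos
    hmom hc hu fun x hx => ?_
  rw [abs_of_pos (pathKernel_pos hα0 hlam hc hu hx.le), one_mul]
  exact le_mul_of_one_le_right (pathKernel_pos hα0 hlam hc hu hx.le).le
    (by linarith [one_add_le_cube hu hx])

lemma integrable_pathFlux (hα : 1 / 2 ≤ α) (hlam : 0 < lam)
    (hpos : ∀ᵐ x ∂μ, 0 < x) (hmom : Integrable (fun x => (1 + x) ^ (α + 4)) μ)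
    (hc : lam ≤ c) (hu : 0 < u) : Integrable (pathFlux α lam c u) μ := by
  have hα0 : 0 < α := by linarith
  refine integrable_of_abs_le_pathKernel (continuous_pathFlux hα0 lam c u)
    (K := (c + c ^ 2 / α) * u) hα hlam hpos hmom hc hu fun x hx => ?_
  have hc0 : 0 < c := hlam.trans_le hc
  refine (abs_pathFlux_le hα0 hlam hc le_rfl hu hx).trans ?_
  rw [mul_assoc]
  refine mul_le_mul_of_nonneg_left (mul_le_mul_of_nonneg_left ?_ hu.le) (by positivity)
  exact pathKernel_mul_le_mul_cube hα0 hlam hc hu hx (one_add_le_cube hu hx)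

lemma hasDerivAt_mixDensity_rate (hα : 1 / 2 ≤ α) (hlam : 0 < lam)
    (hpos : ∀ᵐ x ∂μ, 0 < x) (hmom : Integrable (fun x => (1 + x) ^ (α + 4)) μ)
    (hc : lam < c) (hu : 0 < u) :
    HasDerivAt (fun s => mixDensity α lam μ s u) (mixDensityDeriv α lam μ c u) c := by
  have hα0 : 0 < α := by linarith
  obtain ⟨C, hC, hC'⟩ := exists_pathKernel_mul_le hα hlam (show lam ≤ c + 1 by linarith)
  have hc0 : 0 < c := hlam.trans hc
  have hK : 0 ≤ α / lam + 1 + 2 * (c + 1) / α := by positivity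
  refine (hasDerivAt_integral_of_dominated_loc_of_deriv_le
    (F' := fun s x => pathKernelDeriv α lam s u x)
    (bound := fun x => (α / lam + 1 + 2 * (c + 1) / α) * (C * envelope α u * (1 + x) ^ (α + 4)))
    (Ioo_mem_nhds hc (lt_add_one c))
    (Eventually.of_forall fun s => (continuous_pathKernel hα0 lam s u).aestronglyMeasurable)
    (integrable_pathKernel hα hlam hpos hmom hc.le hu)
    (continuous_pathKernelDeriv hα0 lam c u).aestronglyMeasurable ?_
    ((hmom.const_mul _).const_mul _) ?_).2
  · filter_upwards [hpos] with x hx s hs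
    refine (abs_pathKernelDeriv_le hα0 hlam hs.1.le hs.2.le hu hx).trans ?_
    refine mul_le_mul_of_nonneg_left (le_trans ?_ (hC' s hs.1.le hs.2.le u hu x hx)) hK
    exact pathKernel_mul_le_mul_cube hα0 hlam hs.1.le hu hx
      (pow_le_pow_right₀ (by linarith) (by norm_num))
  · exact ae_of_all _ fun x s hs => hasDerivAt_pathKernel_rate hα0 (hlam.trans hs.1)

lemma hasDerivAt_mixDensity (hα : 1 / 2 ≤ α) (hlam : 0 < lam)
    (hpos : ∀ᵐ x ∂μ, 0 < x) (hmom : Integrable (fun x => (1 + x) ^ (α + 4)) μ)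
    (hc : lam ≤ c) (hu : 0 < u) :
    HasDerivAt (mixDensity α lam μ c)
      (gammaScore α lam u * mixDensity α lam μ c u + mixFlux α lam μ c u / u) u := by
  have hα0 : 0 < α := by linarith
  have hc0 : 0 < c := hlam.trans_le hc
  obtain ⟨L, hL⟩ := exists_pathKernel_mul_le_of_near hα hlam hc hu
  set K : ℝ := |α - 1| / (u / 2) + lam + (c + c ^ 2 / α) with hK
  have h := (hasDerivAt_integral_of_dominated_loc_of_deriv_le (μ := μ)
    (F := fun v x => pathKernel α lam c v x)
    (F' := fun v x => gammaScore α lam v * pathKernel α lam c v x + pathFlux α lam c v x / v)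
    (bound := fun x => K * (L * (1 + x) ^ (α + 4)))
    (Icc_mem_nhds (half_lt_self hu) (show u < 2 * u by linarith))
    (Eventually.of_forall fun s => (continuous_pathKernel hα0 lam c s).aestronglyMeasurable)
    (integrable_pathKernel hα hlam hpos hmom hc hu)
    (((continuous_pathKernel hα0 lam c u).const_smul (gammaScore α lam u)).add
      ((continuous_pathFlux hα0 lam c u).div_const u)).aestronglyMeasurable ?_
    ((hmom.const_mul _).const_mul _) ?_).2
  · refine h.congr_deriv ?_
    rw [integral_add ((integrable_pathKernel hα hlam hpos hmom hc hu).const_mul _)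
      ((integrable_pathFlux hα hlam hpos hmom hc hu).div_const _), integral_const_mul,
      integral_div]
    rfl
  · filter_upwards [hpos] with x hx v hv
    have hv0 : 0 < v := (half_pos hu).trans_le hv.1
    have hq := pathKernel_pos (x := x) hα0 hlam hc hv0 hx.le
    have h1 : |gammaScore α lam v| ≤ |α - 1| / (u / 2) + lam := by
      refine (abs_sub _ _).trans ?_
      rw [abs_div, abs_of_pos hv0, abs_of_pos hlam]
      gcongr
      exact hv.1
    have h2 : |pathFlux α lam c v x / v| ≤
        (c + c ^ 2 / α) * (pathKernel α lam c v x * (1 + x)) := by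
      rw [abs_div, abs_of_pos hv0, div_le_iff₀ hv0]
      refine (abs_pathFlux_le hα0 hlam hc le_rfl hv0 hx).trans_eq ?_
      ring
    calc ‖gammaScore α lam v * pathKernel α lam c v x + pathFlux α lam c v x / v‖
        ≤ |gammaScore α lam v * pathKernel α lam c v x| + |pathFlux α lam c v x / v| :=
          abs_add_le _ _
      _ ≤ (|α - 1| / (u / 2) + lam) * (pathKernel α lam c v x * (1 + x)) +
          (c + c ^ 2 / α) * (pathKernel α lam c v x * (1 + x)) := by
          refine add_le_add ?_ h2
          rw [abs_mul, abs_of_pos hq]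
          gcongr
          exact le_mul_of_one_le_right hq.le (by linarith)
      _ = K * (pathKernel α lam c v x * (1 + x)) := by rw [hK]; ring
      _ ≤ K * (L * (1 + x) ^ (α + 4)) := by
          refine mul_le_mul_of_nonneg_left ?_ (by positivity)
          exact (pathKernel_mul_le_mul_cube hα0 hlam hc hv0 hx (one_add_le_cube hv0 hx)).trans
            (hL v hv x hx)
  · exact ae_of_all _ fun x v hv => hasDerivAt_pathKernel hα0 ((half_pos hu).trans_le hv.1)

lemma hasDerivAt_mixFlux (hα : 1 / 2 ≤ α) (hlam : 0 < lam)
    (hpos : ∀ᵐ x ∂μ, 0 < x) (hmom : Integrable (fun x => (1 + x) ^ (α + 4)) μ)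
    (hc : lam ≤ c) (hu : 0 < u) :
    HasDerivAt (mixFlux α lam μ c)
      (-(c * (c - lam)) * mixDensityDeriv α lam μ c u) u := by
  have hα0 : 0 < α := by linarith
  have hc0 : 0 < c := hlam.trans_le hc
  have hr : 0 ≤ c - lam := by linarith
  obtain ⟨L, hL⟩ := exists_pathKernel_mul_le_of_near hα hlam hc hu
  set K : ℝ := c * (c - lam) * (α / lam + 1 + 2 * c / α) with hK
  have h := (hasDerivAt_integral_of_dominated_loc_of_deriv_le (μ := μ)
    (F := fun v x => pathFlux α lam c v x)
    (F' := fun v x => -(c * (c - lam)) * pathKernelDeriv α lam c v x)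
    (bound := fun x => K * (L * (1 + x) ^ (α + 4)))
    (Icc_mem_nhds (half_lt_self hu) (show u < 2 * u by linarith))
    (Eventually.of_forall fun s => (continuous_pathFlux hα0 lam c s).aestronglyMeasurable)
    (integrable_pathFlux hα hlam hpos hmom hc hu)
    ((continuous_pathKernelDeriv hα0 lam c u).const_smul
      (-(c * (c - lam)))).aestronglyMeasurable ?_
    ((hmom.const_mul _).const_mul _) ?_).2
  · refine h.congr_deriv ?_
    rw [integral_const_mul]
    rfl
  · filter_upwards [hpos] with x hx v hv
    have hv0 : 0 < v := (half_pos hu).trans_le hv.1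
    rw [Real.norm_eq_abs, abs_mul, abs_neg, abs_of_nonneg (by positivity), hK,
      mul_assoc _ _ (L * _)]
    refine mul_le_mul_of_nonneg_left ?_ (by positivity)
    refine (abs_pathKernelDeriv_le hα0 hlam hc le_rfl hv0 hx).trans ?_
    refine mul_le_mul_of_nonneg_left ?_ (by positivity)
    exact (pathKernel_mul_le_mul_cube hα0 hlam hc hv0 hx
      (pow_le_pow_right₀ (by linarith) (by norm_num))).trans (hL v hv x hx)
  · exact ae_of_all _ fun x v hv => hasDerivAt_pathFlux hα0 hc0 ((half_pos hu).trans_le hv.1)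

end Mixture

/-! ### Dissipation of the relative entropy -/

/-- The logarithm of the density of the smart path with respect to the gamma law. -/
noncomputable def logRatio (α lam : ℝ) (μ : Measure ℝ) (c u : ℝ) : ℝ :=
  Real.log (mixDensity α lam μ c u / gammaPDFReal α lam u)

lemma gammaPDFReal_of_pos {α lam u : ℝ} (hu : 0 < u) :
    gammaPDFReal α lam u = lam ^ α / Real.Gamma α * u ^ (α - 1) * Real.exp (-(lam * u)) := by
  rw [gammaPDFReal, if_pos hu.le]

lemma hasDerivAt_gammaPDFReal {α lam u : ℝ} (hu : 0 < u) :
    HasDerivAt (gammaPDFReal α lam) (gammaScore α lam u * gammaPDFReal α lam u) u := by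
  have h1 := (Real.hasDerivAt_rpow_const (x := u) (p := α - 1) (Or.inl hu.ne')).const_mul
    (lam ^ α / Real.Gamma α)
  have h2 : HasDerivAt (fun v : ℝ => -(lam * v)) (-(lam * 1)) u :=
    ((hasDerivAt_id u).const_mul lam).neg
  have h := (h1.mul h2.exp).congr_of_eventuallyEq (f₁ := gammaPDFReal α lam)
    ((eventually_gt_nhds hu).mono fun v hv => gammaPDFReal_of_pos hv)
  refine h.congr_deriv ?_
  rw [gammaPDFReal_of_pos hu, Real.rpow_sub_one hu.ne' (α - 1), gammaScore]
  field_simp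
  ring

/-- The Cauchy–Schwarz inequality for a nonnegative weight `q`. -/
lemma sq_integral_mul_le {μ : Measure ℝ} {q y : ℝ → ℝ} (hq : 0 ≤ᵐ[μ] q)
    (h0 : Integrable q μ) (h1 : Integrable (fun x => q x * y x) μ)
    (h2 : Integrable (fun x => q x * y x ^ 2) μ) (hpos : 0 < ∫ x, q x ∂μ) :
    (∫ x, q x * y x ∂μ) ^ 2 ≤ (∫ x, q x ∂μ) * ∫ x, q x * y x ^ 2 ∂μ := by
  set A := ∫ x, q x ∂μ
  set B := ∫ x, q x * y x ∂μ
  -- Integrate `q (y - B / A)² ≥ 0`, where `B / A` is the mean of `y` for the weight `q`.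
  have h : 0 ≤ ∫ x, (q x * y x ^ 2 - 2 * (B / A) * (q x * y x) + (B / A) ^ 2 * q x) ∂μ := by
    refine integral_nonneg_of_ae (hq.mono fun x hx => ?_)
    have hx' : 0 ≤ q x := hx
    have e : q x * y x ^ 2 - 2 * (B / A) * (q x * y x) + (B / A) ^ 2 * q x =
      q x * (y x - B / A) ^ 2 := by ring
    simp only [Pi.zero_apply, e]
    positivity
  have i1 : Integrable (fun x => 2 * (B / A) * (q x * y x)) μ := h1.const_mul _
  have i2 : Integrable (fun x => q x * y x ^ 2 - 2 * (B / A) * (q x * y x)) μ := h2.sub i1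
  rw [integral_add i2 (h0.const_mul _), integral_sub h2 i1, integral_const_mul,
    integral_const_mul] at h
  change 0 ≤ _ - 2 * (B / A) * B + (B / A) ^ 2 * A at h
  have e : A * ((∫ x, q x * y x ^ 2 ∂μ) - 2 * (B / A) * B + (B / A) ^ 2 * A) =
      A * (∫ x, q x * y x ^ 2 ∂μ) - B ^ 2 := by
    field_simp
    ring
  nlinarith [mul_nonneg hpos.le h]

section Entropy

variable {α lam c M u : ℝ} {μ : Measure ℝ}

lemma integrable_exp_neg_mul [IsFiniteMeasure μ] (hM : 0 ≤ M) (hpos : ∀ᵐ x ∂μ, 0 < x) :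
    Integrable (fun x => Real.exp (-(M * x))) μ := by
  refine (integrable_const (1 : ℝ)).mono' (by fun_prop : Continuous _).aestronglyMeasurable ?_
  filter_upwards [hpos] with x hx
  rw [Real.norm_of_nonneg (by positivity), Real.exp_le_one_iff]
  nlinarith

lemma integral_exp_neg_mul_pos [IsProbabilityMeasure μ] (hM : 0 ≤ M) (hpos : ∀ᵐ x ∂μ, 0 < x) :
    0 < ∫ x, Real.exp (-(M * x)) ∂μ := by
  rw [integral_pos_iff_support_of_nonneg (fun x => by positivity) (integrable_exp_neg_mul hM hpos)]
  have : (Function.support fun x => Real.exp (-(M * x))) = univ := by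
    ext x; simp [Real.exp_ne_zero]
  simp [this]

lemma le_mixDensity [IsProbabilityMeasure μ]
    (hα : 1 / 2 ≤ α) (hlam : 0 < lam)
    (hpos : ∀ᵐ x ∂μ, 0 < x) (hmom : Integrable (fun x => (1 + x) ^ (α + 4)) μ)
    (hc : lam ≤ c) (hcM : c ≤ M) (hu : 0 < u) :
    lam ^ α * (Real.Gamma α)⁻¹ * u ^ (α - 1) * Real.exp (-(M * u)) *
      ∫ x, Real.exp (-(M * x)) ∂μ ≤ mixDensity α lam μ c u := by
  have hM : 0 ≤ M := by linarith
  rw [← integral_const_mul]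
  exact integral_mono_ae ((integrable_exp_neg_mul hM hpos).const_mul _)
    (integrable_pathKernel hα hlam hpos hmom hc hu)
    (hpos.mono fun x hx => le_pathKernel (by linarith) hlam hc hcM hu (le_of_lt hx))

lemma mixDensity_le [IsProbabilityMeasure μ]
    (hα : 1 / 2 ≤ α) (hlam : 0 < lam)
    (hpos : ∀ᵐ x ∂μ, 0 < x) (hmom : Integrable (fun x => (1 + x) ^ (α + 4)) μ)
    (hc : lam ≤ c) (hcM : c ≤ M) (hu : 0 < u) :
    mixDensity α lam μ c u ≤ M ^ α * (Real.Gamma α)⁻¹ * u ^ (α - 1) := by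
  have h := integral_mono_ae (integrable_pathKernel hα hlam hpos hmom hc hu)
    (integrable_const (M ^ α * (Real.Gamma α)⁻¹ * u ^ (α - 1)))
    (hpos.mono fun x hx => pathKernel_le hα hlam hc hcM hu (le_of_lt hx))
  simpa [mixDensity] using h

lemma mixDensity_pos [IsProbabilityMeasure μ]
    (hα : 1 / 2 ≤ α) (hlam : 0 < lam)
    (hpos : ∀ᵐ x ∂μ, 0 < x) (hmom : Integrable (fun x => (1 + x) ^ (α + 4)) μ)
    (hc : lam ≤ c) (hu : 0 < u) : 0 < mixDensity α lam μ c u := by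
  refine lt_of_lt_of_le ?_ (le_mixDensity hα hlam hpos hmom hc le_rfl hu)
  have := integral_exp_neg_mul_pos (hlam.le.trans hc) hpos
  have hG := Real.Gamma_pos_of_pos (show 0 < α by linarith)
  positivity

/-- The density ratio lies between two exponentials, so that its logarithm grows at most linearly,
uniformly for `c` in `[lam, M]`. -/
lemma exists_abs_logRatio_le [IsProbabilityMeasure μ]
    (hα : 1 / 2 ≤ α) (hlam : 0 < lam)
    (hpos : ∀ᵐ x ∂μ, 0 < x) (hmom : Integrable (fun x => (1 + x) ^ (α + 4)) μ) (hM : lam ≤ M) :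
    ∃ C, 0 ≤ C ∧ ∀ c, lam ≤ c → c ≤ M → ∀ u, 0 < u → |logRatio α lam μ c u| ≤ C * (1 + u) := by
  have hM0 : 0 < M := hlam.trans_le hM
  have hα0 : 0 < α := by linarith
  have hG := Real.Gamma_pos_of_pos hα0
  have hm := integral_exp_neg_mul_pos hM0.le hpos
  set m := ∫ x, Real.exp (-(M * x)) ∂μ with hmdef
  refine ⟨|Real.log m| + |α * Real.log (M / lam)| + M, by positivity, fun c hc hcM u hu => ?_⟩
  have hg := mixDensity_pos hα hlam hpos hmom hc hu
  have hγ := gammaPDFReal_pos hα0 hlam hu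
  have hlow : Real.exp (-(M * u)) * m ≤ mixDensity α lam μ c u / gammaPDFReal α lam u := by
    rw [le_div_iff₀ hγ, gammaPDFReal_of_pos hu]
    refine le_trans ?_ (le_mixDensity hα hlam hpos hmom hc hcM hu)
    have h1 : Real.exp (-(lam * u)) ≤ 1 := Real.exp_le_one_iff.2 (by nlinarith)
    calc _ = lam ^ α * (Real.Gamma α)⁻¹ * u ^ (α - 1) * Real.exp (-(M * u)) * m *
          Real.exp (-(lam * u)) := by ring
      _ ≤ _ := mul_le_of_le_one_right (by positivity) h1
  have hup : mixDensity α lam μ c u / gammaPDFReal α lam u ≤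
      (M / lam) ^ α * Real.exp (lam * u) := by
    rw [div_le_iff₀ hγ, gammaPDFReal_of_pos hu]
    refine (mixDensity_le hα hlam hpos hmom hc hcM hu).trans_eq ?_
    rw [Real.div_rpow hM0.le hlam.le, Real.exp_neg]
    field_simp
  have h1 := Real.log_le_log (by positivity) hlow
  have h2 := Real.log_le_log (div_pos hg hγ) hup
  rw [Real.log_mul (by positivity) hm.ne', Real.log_exp] at h1
  rw [Real.log_mul (by positivity) (by positivity), Real.log_exp,
    Real.log_rpow (by positivity)] at h2
  have h3 := neg_abs_le (Real.log m)
  have h4 := le_abs_self (α * Real.log (M / lam))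
  have h5 := abs_nonneg (Real.log m)
  have h6 := abs_nonneg (α * Real.log (M / lam))
  rw [logRatio, abs_le]
  constructor <;> nlinarith

lemma exists_mixDensity_mul_le (hα : 1 / 2 ≤ α) (hlam : 0 < lam)
    (hpos : ∀ᵐ x ∂μ, 0 < x) (hmom : Integrable (fun x => (1 + x) ^ (α + 4)) μ) (hM : lam ≤ M) :
    ∃ C, 0 ≤ C ∧ ∀ c, lam ≤ c → c ≤ M → ∀ u, 0 < u →
      mixDensity α lam μ c u * (1 + u) ≤ C * envelope α u := by
  obtain ⟨C, hC, hC'⟩ := exists_integral_pathKernel_mul_le hα hlam hpos hmom hM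
  refine ⟨C, hC, fun c hc hcM u hu => (le_trans ?_ (hC' c hc hcM u hu))⟩
  rw [mixDensity, ← integral_mul_const]
  refine integral_mono_ae ((integrable_pathKernel hα hlam hpos hmom hc hu).mul_const _)
    (integrable_pathKernel_mul hα hlam hpos hmom hc hu) (hpos.mono fun x hx => ?_)
  have hx : 0 < x := hx
  refine pathKernel_mul_le_mul_cube (by linarith) hlam hc hu hx ?_
  exact (by linarith : 1 + u ≤ 1 + u + x).trans (le_self_pow₀ (by linarith) (by norm_num))

lemma exists_abs_mixDensityDeriv_mul_le (hα : 1 / 2 ≤ α) (hlam : 0 < lam)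
    (hpos : ∀ᵐ x ∂μ, 0 < x) (hmom : Integrable (fun x => (1 + x) ^ (α + 4)) μ) (hM : lam ≤ M) :
    ∃ C, 0 ≤ C ∧ ∀ c, lam ≤ c → c ≤ M → ∀ u, 0 < u →
      |mixDensityDeriv α lam μ c u| * (1 + u) ≤ C * envelope α u := by
  obtain ⟨C, hC, hC'⟩ := exists_integral_pathKernel_mul_le hα hlam hpos hmom hM
  have hα0 : 0 < α := by linarith
  have hM0 : 0 < M := hlam.trans_le hM
  set K := α / lam + 1 + 2 * M / α with hK
  have hK0 : 0 ≤ K := by positivity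
  refine ⟨K * C, by positivity, fun c hc hcM u hu => ?_⟩
  have h1 : |mixDensityDeriv α lam μ c u| * (1 + u) ≤
      ∫ x, K * (pathKernel α lam c u x * (1 + u + x) ^ 3) ∂μ := by
    have h : |mixDensityDeriv α lam μ c u| * (1 + u) =
        |∫ x, pathKernelDeriv α lam c u x * (1 + u) ∂μ| := by
      rw [integral_mul_const, abs_mul, abs_of_pos (show 0 < 1 + u by linarith)]
      rfl
    rw [h]
    refine norm_integral_le_of_norm_le (G := ℝ)
      ((integrable_pathKernel_mul hα hlam hpos hmom hc hu).const_mul K)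
      (hpos.mono fun x hx => ?_)
    have hx : 0 < x := hx
    have hq := pathKernel_pos (x := x) hα0 hlam hc hu hx.le
    rw [Real.norm_eq_abs, abs_mul, abs_of_pos (show 0 < 1 + u by linarith)]
    calc _ ≤ K * (pathKernel α lam c u x * (1 + u + x) ^ 2) * (1 + u + x) := by
          refine mul_le_mul (abs_pathKernelDeriv_le hα0 hlam hc hcM hu hx) ?_ (by linarith)
            (by positivity)
          linarith
      _ = _ := by ring
  refine h1.trans ?_
  rw [integral_const_mul, mul_assoc]
  exact mul_le_mul_of_nonneg_left (hC' c hc hcM u hu) hK0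

lemma exists_abs_mixFlux_mul_le (hα : 1 / 2 ≤ α) (hlam : 0 < lam)
    (hpos : ∀ᵐ x ∂μ, 0 < x) (hmom : Integrable (fun x => (1 + x) ^ (α + 4)) μ) (hc : lam ≤ c) :
    ∃ C, 0 ≤ C ∧ ∀ u, 0 < u → |mixFlux α lam μ c u| * (1 + u) ≤ C * (u * envelope α u) := by
  obtain ⟨C, hC, hC'⟩ := exists_integral_pathKernel_mul_le hα hlam hpos hmom hc
  have hα0 : 0 < α := by linarith
  have hc0 : 0 < c := hlam.trans_le hc
  set K := c + c ^ 2 / α with hK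
  have hK0 : 0 ≤ K := by positivity
  refine ⟨K * C, by positivity, fun u hu => ?_⟩
  have h1 : |mixFlux α lam μ c u| * (1 + u) ≤
      ∫ x, K * u * (pathKernel α lam c u x * (1 + u + x) ^ 3) ∂μ := by
    have h : |mixFlux α lam μ c u| * (1 + u) =
        |∫ x, pathFlux α lam c u x * (1 + u) ∂μ| := by
      rw [integral_mul_const, abs_mul, abs_of_pos (show 0 < 1 + u by linarith)]
      rfl
    rw [h]
    refine norm_integral_le_of_norm_le (G := ℝ)
      ((integrable_pathKernel_mul hα hlam hpos hmom hc hu).const_mul (K * u))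
      (hpos.mono fun x hx => ?_)
    have hx : 0 < x := hx
    have hq := pathKernel_pos (x := x) hα0 hlam hc hu hx.le
    rw [Real.norm_eq_abs, abs_mul, abs_of_pos (show 0 < 1 + u by linarith)]
    calc _ ≤ K * (u * (pathKernel α lam c u x * (1 + x))) * (1 + u) := by
          gcongr
          exact abs_pathFlux_le hα0 hlam hc le_rfl hu hx
      _ = K * u * (pathKernel α lam c u x * ((1 + x) * (1 + u))) := by ring
      _ ≤ _ := by
          refine mul_le_mul_of_nonneg_left ?_ (by positivity)
          refine pathKernel_mul_le_mul_cube hα0 hlam hc hu hx ?_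
          calc (1 + x) * (1 + u) ≤ (1 + u + x) * (1 + u + x) :=
              mul_le_mul (by linarith) (by linarith) (by linarith) (by linarith)
            _ = (1 + u + x) ^ 2 := by ring
            _ ≤ _ := pow_le_pow_right₀ (by linarith) (by norm_num)
  refine h1.trans ?_
  rw [integral_const_mul]
  calc _ ≤ K * u * (C * envelope α u) :=
        mul_le_mul_of_nonneg_left (hC' c hc le_rfl u hu) (by positivity)
    _ = _ := by ring

/-- The Fisher information integrand `Φ² / (u g)`, where `Φ` is the flux, is dominated thanks to
`|Φ| ≤ K u E[q (1 + X)]` and the Cauchy–Schwarz inequality. -/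
lemma exists_sq_mixFlux_div_le [IsProbabilityMeasure μ]
    (hα : 1 / 2 ≤ α) (hlam : 0 < lam)
    (hpos : ∀ᵐ x ∂μ, 0 < x) (hmom : Integrable (fun x => (1 + x) ^ (α + 4)) μ) (hc : lam ≤ c) :
    ∃ C, 0 ≤ C ∧ ∀ u, 0 < u →
      mixFlux α lam μ c u ^ 2 / (u * mixDensity α lam μ c u) ≤ C * envelope α u := by
  obtain ⟨C, hC, hC'⟩ := exists_integral_pathKernel_mul_le hα hlam hpos hmom hc
  have hα0 : 0 < α := by linarith
  have hc0 : 0 < c := hlam.trans_le hc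
  set K := c + c ^ 2 / α with hK
  have hK0 : 0 ≤ K := by positivity
  refine ⟨K ^ 2 * C, by positivity, fun u hu => ?_⟩
  have hg := mixDensity_pos hα hlam hpos hmom hc hu
  have hcont := continuous_pathKernel hα0 lam c u
  have hq0 : ∀ x, 0 < x → 0 < pathKernel α lam c u x := fun x hx =>
    pathKernel_pos hα0 hlam hc hu hx.le
  have i1 : Integrable (fun x => pathKernel α lam c u x * (1 + x)) μ := by
    refine integrable_of_abs_le_pathKernel (by fun_prop) (K := 1) hα hlam hpos hmom hc hu
      fun x hx => ?_
    rw [abs_of_pos (mul_pos (hq0 x hx) (by linarith)), one_mul]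
    exact pathKernel_mul_le_mul_cube hα0 hlam hc hu hx (one_add_le_cube hu hx)
  have i2 : Integrable (fun x => pathKernel α lam c u x * (1 + x) ^ 2) μ := by
    refine integrable_of_abs_le_pathKernel (by fun_prop) (K := 1) hα hlam hpos hmom hc hu
      fun x hx => ?_
    rw [abs_of_pos (mul_pos (hq0 x hx) (by positivity)), one_mul]
    refine pathKernel_mul_le_mul_cube hα0 hlam hc hu hx ?_
    calc (1 + x) ^ 2 ≤ (1 + u + x) ^ 2 := by gcongr; linarith
      _ ≤ _ := pow_le_pow_right₀ (by linarith) (by norm_num)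
  have hΦ : |mixFlux α lam μ c u| ≤ K * u * ∫ x, pathKernel α lam c u x * (1 + x) ∂μ := by
    rw [← integral_const_mul]
    refine norm_integral_le_of_norm_le (G := ℝ) (i1.const_mul _) (hpos.mono fun x hx => ?_)
    exact (abs_pathFlux_le hα0 hlam hc le_rfl hu hx).trans_eq (by rw [hK]; ring)
  have hCS := sq_integral_mul_le (μ := μ) (q := pathKernel α lam c u) (y := fun x => 1 + x)
    (hpos.mono fun x hx => (hq0 x hx).le) (integrable_pathKernel hα hlam hpos hmom hc hu) i1 i2 hg
  have hlast : u * ∫ x, pathKernel α lam c u x * (1 + x) ^ 2 ∂μ ≤ C * envelope α u := by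
    refine le_trans ?_ (hC' c hc le_rfl u hu)
    rw [← integral_const_mul]
    refine integral_mono_ae (i2.const_mul _)
      (integrable_pathKernel_mul hα hlam hpos hmom hc hu) (hpos.mono fun x hx => ?_)
    have hx : 0 < x := hx
    calc u * (pathKernel α lam c u x * (1 + x) ^ 2)
        = pathKernel α lam c u x * (u * (1 + x) ^ 2) := by ring
      _ ≤ _ := by
          refine pathKernel_mul_le_mul_cube hα0 hlam hc hu hx ?_
          calc u * (1 + x) ^ 2 ≤ (1 + u + x) * (1 + u + x) ^ 2 := by gcongr <;> linarith
            _ = _ := by ring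
  rw [div_le_iff₀ (by positivity)]
  calc mixFlux α lam μ c u ^ 2
      = |mixFlux α lam μ c u| ^ 2 := (sq_abs _).symm
    _ ≤ (K * u * ∫ x, pathKernel α lam c u x * (1 + x) ∂μ) ^ 2 := by gcongr
    _ = K ^ 2 * u ^ 2 * (∫ x, pathKernel α lam c u x * (1 + x) ∂μ) ^ 2 := by ring
    _ ≤ K ^ 2 * u ^ 2 * (mixDensity α lam μ c u *
          ∫ x, pathKernel α lam c u x * (1 + x) ^ 2 ∂μ) := by gcongr; exact hCS
    _ = K ^ 2 * (u * ∫ x, pathKernel α lam c u x * (1 + x) ^ 2 ∂μ) *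
          (u * mixDensity α lam μ c u) := by ring
    _ ≤ K ^ 2 * (C * envelope α u) * (u * mixDensity α lam μ c u) := by gcongr
    _ = _ := by ring

lemma hasDerivAt_logRatio [IsProbabilityMeasure μ]
    (hα : 1 / 2 ≤ α) (hlam : 0 < lam)
    (hpos : ∀ᵐ x ∂μ, 0 < x) (hmom : Integrable (fun x => (1 + x) ^ (α + 4)) μ)
    (hc : lam ≤ c) (hu : 0 < u) :
    HasDerivAt (logRatio α lam μ c)
      (mixFlux α lam μ c u / (u * mixDensity α lam μ c u)) u := by
  have hg := mixDensity_pos hα hlam hpos hmom hc hu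
  have hγ := gammaPDFReal_pos (show 0 < α by linarith) hlam hu
  have h := ((hasDerivAt_mixDensity hα hlam hpos hmom hc hu).div
    (hasDerivAt_gammaPDFReal hu) hγ.ne').log (div_pos hg hγ).ne'
  refine h.congr_deriv ?_
  simp only [Pi.div_apply]
  field_simp
  ring

/-- The integrand of the relative entropy, in the form `γ klFun(g / γ)`: it is nonnegative, and its
derivative in `g` is `log (g / γ)`, without the constant that `g log (g / γ)` would give. -/
noncomputable def entropyIntegrand (α lam : ℝ) (μ : Measure ℝ) (c u : ℝ) : ℝ :=
  gammaPDFReal α lam u *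
    InformationTheory.klFun (mixDensity α lam μ c u / gammaPDFReal α lam u)

lemma hasDerivAt_entropyIntegrand [IsProbabilityMeasure μ]
    (hα : 1 / 2 ≤ α) (hlam : 0 < lam)
    (hpos : ∀ᵐ x ∂μ, 0 < x) (hmom : Integrable (fun x => (1 + x) ^ (α + 4)) μ)
    (hc : lam < c) (hu : 0 < u) :
    HasDerivAt (fun s => entropyIntegrand α lam μ s u)
      (mixDensityDeriv α lam μ c u * logRatio α lam μ c u) c := by
  have hg := mixDensity_pos hα hlam hpos hmom hc.le hu
  have hγ := gammaPDFReal_pos (show 0 < α by linarith) hlam hu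
  have h := ((InformationTheory.hasDerivAt_klFun (div_pos hg hγ).ne').comp c
    ((hasDerivAt_mixDensity_rate hα hlam hpos hmom hc hu).div_const
      (gammaPDFReal α lam u))).const_mul (gammaPDFReal α lam u)
  refine h.congr_deriv ?_
  rw [logRatio]
  field_simp

lemma entropyIntegrand_eq (hα : 0 < α) (hlam : 0 < lam) (hu : 0 < u) :
    entropyIntegrand α lam μ c u = mixDensity α lam μ c u * logRatio α lam μ c u +
      gammaPDFReal α lam u - mixDensity α lam μ c u := by
  have hγ := gammaPDFReal_pos hα hlam hu
  rw [entropyIntegrand, InformationTheory.klFun, logRatio]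
  field_simp

lemma aestronglyMeasurable_of_continuousAt {f : ℝ → ℝ} (h : ∀ u, 0 < u → ContinuousAt f u) :
    AEStronglyMeasurable f (volume.restrict (Ioi 0)) :=
  ContinuousOn.aestronglyMeasurable (fun u hu => (h u hu).continuousWithinAt) measurableSet_Ioi

/-- As a function of `u`, the derivative in `c` is measurable because the evolution equation makes
it a multiple of a derivative in `u`. -/
lemma aestronglyMeasurable_mixDensityDeriv (hα : 1 / 2 ≤ α) (hlam : 0 < lam)
    (hpos : ∀ᵐ x ∂μ, 0 < x) (hmom : Integrable (fun x => (1 + x) ^ (α + 4)) μ)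
    (hc : lam < c) :
    AEStronglyMeasurable (mixDensityDeriv α lam μ c) (volume.restrict (Ioi 0)) := by
  have hcr : 0 < c * (c - lam) := mul_pos (hlam.trans hc) (sub_pos.2 hc)
  have h : AEStronglyMeasurable (fun u => (-(c * (c - lam)))⁻¹ * deriv (mixFlux α lam μ c) u)
      (volume.restrict (Ioi 0)) :=
    ((measurable_deriv _).const_mul _).aestronglyMeasurable
  refine h.congr ((ae_restrict_iff' measurableSet_Ioi).2 (ae_of_all _ fun u hu => ?_))
  change _ * deriv (mixFlux α lam μ c) u = _
  rw [(hasDerivAt_mixFlux hα hlam hpos hmom hc.le hu).deriv,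
    inv_mul_cancel_left₀ (neg_ne_zero.2 hcr.ne')]

lemma continuousAt_mixDensity (hα : 1 / 2 ≤ α) (hlam : 0 < lam)
    (hpos : ∀ᵐ x ∂μ, 0 < x) (hmom : Integrable (fun x => (1 + x) ^ (α + 4)) μ)
    (hc : lam ≤ c) (hu : 0 < u) : ContinuousAt (mixDensity α lam μ c) u :=
  (hasDerivAt_mixDensity hα hlam hpos hmom hc hu).continuousAt

lemma continuousAt_entropyIntegrand [IsProbabilityMeasure μ]
    (hα : 1 / 2 ≤ α) (hlam : 0 < lam)
    (hpos : ∀ᵐ x ∂μ, 0 < x) (hmom : Integrable (fun x => (1 + x) ^ (α + 4)) μ)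
    (hc : lam ≤ c) (hu : 0 < u) : ContinuousAt (entropyIntegrand α lam μ c) u := by
  have hγ := gammaPDFReal_pos (show 0 < α by linarith) hlam hu
  have h1 := continuousAt_mixDensity hα hlam hpos hmom hc hu
  have h2 := (hasDerivAt_gammaPDFReal (α := α) (lam := lam) hu).continuousAt
  exact h2.mul (InformationTheory.continuous_klFun.continuousAt.comp (h1.div h2 hγ.ne'))

lemma integrableOn_entropyIntegrand [IsProbabilityMeasure μ]
    (hα : 1 / 2 ≤ α) (hlam : 0 < lam)
    (hpos : ∀ᵐ x ∂μ, 0 < x) (hmom : Integrable (fun x => (1 + x) ^ (α + 4)) μ)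
    (hc : lam ≤ c) : IntegrableOn (entropyIntegrand α lam μ c) (Ioi 0) := by
  have hα0 : 0 < α := by linarith
  obtain ⟨C₁, hC₁, hC₁'⟩ := exists_abs_logRatio_le hα hlam hpos hmom hc
  obtain ⟨C₂, hC₂, hC₂'⟩ := exists_mixDensity_mul_le hα hlam hpos hmom hc
  have hγint : IntegrableOn (gammaPDFReal α lam) (Ioi 0) := by
    refine Integrable.integrableOn ⟨(measurable_gammaPDFReal α lam).aestronglyMeasurable, ?_⟩
    rw [hasFiniteIntegral_iff_ofReal (ae_of_all _ (gammaPDFReal_nonneg hα0 hlam))]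
    exact (lintegral_gammaPDF_eq_one hα0 hlam).trans_lt ENNReal.one_lt_top
  refine Integrable.mono' (((integrableOn_envelope hα0).const_mul ((C₁ + 1) * C₂)).add hγint)
    (aestronglyMeasurable_of_continuousAt fun u hu =>
      continuousAt_entropyIntegrand hα hlam hpos hmom hc hu) ?_
  refine (ae_restrict_iff' measurableSet_Ioi).2 (ae_of_all _ fun u (hu : 0 < u) => ?_)
  have hg := mixDensity_pos hα hlam hpos hmom hc hu
  have hγ := gammaPDFReal_pos hα0 hlam hu
  have h1 := hC₁' c hc le_rfl u hu
  have h2 := hC₂' c hc le_rfl u hu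
  rw [entropyIntegrand_eq hα0 hlam hu, Real.norm_eq_abs]
  have h3 : |mixDensity α lam μ c u * logRatio α lam μ c u| ≤
      C₁ * (mixDensity α lam μ c u * (1 + u)) := by
    rw [abs_mul, abs_of_pos hg]
    calc _ ≤ mixDensity α lam μ c u * (C₁ * (1 + u)) := by gcongr
      _ = _ := by ring
  have h4 : mixDensity α lam μ c u ≤ mixDensity α lam μ c u * (1 + u) :=
    le_mul_of_one_le_right hg.le (by linarith)
  have h5 : (C₁ + 1) * (mixDensity α lam μ c u * (1 + u)) ≤ (C₁ + 1) * (C₂ * envelope α u) := by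
    gcongr
  change _ ≤ (C₁ + 1) * C₂ * envelope α u + gammaPDFReal α lam u
  rw [abs_le] at h3 ⊢
  constructor <;> nlinarith

lemma integrableOn_sq_mixFlux_div [IsProbabilityMeasure μ] (hα : 1 / 2 ≤ α) (hlam : 0 < lam)
    (hpos : ∀ᵐ x ∂μ, 0 < x) (hmom : Integrable (fun x => (1 + x) ^ (α + 4)) μ)
    (hc : lam ≤ c) :
    IntegrableOn (fun u => mixFlux α lam μ c u ^ 2 / (u * mixDensity α lam μ c u)) (Ioi 0) := by
  obtain ⟨C, hC, hC'⟩ := exists_sq_mixFlux_div_le hα hlam hpos hmom hc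
  refine Integrable.mono' ((integrableOn_envelope (show 0 < α by linarith)).const_mul C)
    (aestronglyMeasurable_of_continuousAt fun u hu => ?_) ?_
  · have hg := mixDensity_pos hα hlam hpos hmom hc hu
    exact ((hasDerivAt_mixFlux hα hlam hpos hmom hc hu).continuousAt.pow 2).div
      (continuousAt_id.mul (continuousAt_mixDensity hα hlam hpos hmom hc hu)) (mul_pos hu hg).ne'
  · refine (ae_restrict_iff' measurableSet_Ioi).2 (ae_of_all _ fun u (hu : 0 < u) => ?_)
    have hg := mixDensity_pos hα hlam hpos hmom hc hu
    rw [Real.norm_of_nonneg (by positivity)]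
    exact hC' u hu

/-- Dissipation of entropy, by parts: the boundary terms vanish since the flux times the logarithm
is dominated by `u * envelope α u`. -/
lemma integral_mixDensityDeriv_mul_logRatio [IsProbabilityMeasure μ]
    (hα : 1 / 2 ≤ α) (hlam : 0 < lam)
    (hpos : ∀ᵐ x ∂μ, 0 < x) (hmom : Integrable (fun x => (1 + x) ^ (α + 4)) μ)
    (hc : lam < c) :
    c * (c - lam) * ∫ u in Ioi 0, mixDensityDeriv α lam μ c u * logRatio α lam μ c u =
      ∫ u in Ioi 0, mixFlux α lam μ c u ^ 2 / (u * mixDensity α lam μ c u) := by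
  have hα0 : 0 < α := by linarith
  have hcr : c * (c - lam) ≠ 0 := (mul_pos (hlam.trans hc) (sub_pos.2 hc)).ne'
  obtain ⟨C₁, hC₁, hC₁'⟩ := exists_abs_logRatio_le hα hlam hpos hmom hc.le
  obtain ⟨C₂, hC₂, hC₂'⟩ := exists_abs_mixFlux_mul_le hα hlam hpos hmom hc.le
  obtain ⟨C₄, hC₄, hC₄'⟩ := exists_abs_mixDensityDeriv_mul_le hα hlam hpos hmom hc.le
  have hΦ : ∀ u, 0 < u → HasDerivAt (mixFlux α lam μ c)
      (-(c * (c - lam)) * mixDensityDeriv α lam μ c u) u := fun u hu =>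
    hasDerivAt_mixFlux hα hlam hpos hmom hc.le hu
  have hℓ : ∀ u, 0 < u → HasDerivAt (logRatio α lam μ c)
      (mixFlux α lam μ c u / (u * mixDensity α lam μ c u)) u := fun u hu =>
    hasDerivAt_logRatio hα hlam hpos hmom hc.le hu
  have hbd : ∀ u, 0 < u → ‖mixFlux α lam μ c u * logRatio α lam μ c u‖ ≤
      C₁ * C₂ * (u * envelope α u) := by
    intro u hu
    rw [norm_mul, Real.norm_eq_abs, Real.norm_eq_abs]
    calc _ ≤ |mixFlux α lam μ c u| * (C₁ * (1 + u)) := by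
          gcongr; exact hC₁' c hc.le le_rfl u hu
      _ = C₁ * (|mixFlux α lam μ c u| * (1 + u)) := by ring
      _ ≤ C₁ * (C₂ * (u * envelope α u)) := mul_le_mul_of_nonneg_left (hC₂' u hu) hC₁
      _ = _ := by ring
  have hmeas := aestronglyMeasurable_mixDensityDeriv hα hlam hpos hmom hc
  have i1 : IntegrableOn (mixFlux α lam μ c * fun u =>
      mixFlux α lam μ c u / (u * mixDensity α lam μ c u)) (Ioi 0) := by
    refine (integrableOn_sq_mixFlux_div hα hlam hpos hmom hc.le).congr_fun (fun u _ => ?_)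
      measurableSet_Ioi
    rw [Pi.mul_apply]
    ring
  have i2 : IntegrableOn ((fun u => -(c * (c - lam)) * mixDensityDeriv α lam μ c u) *
      logRatio α lam μ c) (Ioi 0) := by
    refine Integrable.mono'
      ((integrableOn_envelope hα0).const_mul (|-(c * (c - lam))| * (C₁ * C₄)))
      ((hmeas.const_mul _).mul (aestronglyMeasurable_of_continuousAt fun u hu =>
        (hℓ u hu).continuousAt)) ?_
    refine (ae_restrict_iff' measurableSet_Ioi).2 (ae_of_all _ fun u (hu : 0 < u) => ?_)
    rw [Pi.mul_apply, norm_mul, norm_mul, Real.norm_eq_abs, Real.norm_eq_abs, Real.norm_eq_abs]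
    calc _ ≤ |-(c * (c - lam))| * |mixDensityDeriv α lam μ c u| * (C₁ * (1 + u)) := by
          gcongr; exact hC₁' c hc.le le_rfl u hu
      _ = |-(c * (c - lam))| * (C₁ * (|mixDensityDeriv α lam μ c u| * (1 + u))) := by ring
      _ ≤ |-(c * (c - lam))| * (C₁ * (C₄ * envelope α u)) := by
          refine mul_le_mul_of_nonneg_left (mul_le_mul_of_nonneg_left ?_ hC₁) (abs_nonneg _)
          exact hC₄' c hc.le le_rfl u hu
      _ = _ := by ring
  have hzero : Tendsto (mixFlux α lam μ c * logRatio α lam μ c) (𝓝[>] 0) (𝓝 0) := by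
    refine squeeze_zero_norm' ?_
      (by simpa using (tendsto_mul_envelope_zero hα0).const_mul (C₁ * C₂))
    filter_upwards [self_mem_nhdsWithin] with u hu using hbd u hu
  have htop : Tendsto (mixFlux α lam μ c * logRatio α lam μ c) atTop (𝓝 0) := by
    refine squeeze_zero_norm' ?_
      (by simpa using (tendsto_mul_envelope_atTop hα0).const_mul (C₁ * C₂))
    filter_upwards [eventually_gt_atTop 0] with u hu using hbd u hu
  have hparts := integral_Ioi_mul_deriv_eq_deriv_mul (fun u hu => hΦ u hu) (fun u hu => hℓ u hu)
    i1 i2 hzero htop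
  rw [sub_zero, zero_sub, ← integral_neg] at hparts
  rw [← integral_const_mul]
  calc _ = ∫ u in Ioi 0, -(-(c * (c - lam)) * mixDensityDeriv α lam μ c u *
        logRatio α lam μ c u) := by congr 1; ext u; ring
    _ = _ := hparts.symm
    _ = _ := by congr 1; ext u; ring

/-- The derivative of the relative entropy in the parameter `c`. -/
lemma hasDerivAt_integral_entropyIntegrand [IsProbabilityMeasure μ]
    (hα : 1 / 2 ≤ α) (hlam : 0 < lam)
    (hpos : ∀ᵐ x ∂μ, 0 < x) (hmom : Integrable (fun x => (1 + x) ^ (α + 4)) μ)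
    (hc : lam < c) :
    HasDerivAt (fun s => ∫ u in Ioi 0, entropyIntegrand α lam μ s u)
      ((∫ u in Ioi 0, mixFlux α lam μ c u ^ 2 / (u * mixDensity α lam μ c u)) /
        (c * (c - lam))) c := by
  have hα0 : 0 < α := by linarith
  have hcr : 0 < c * (c - lam) := mul_pos (hlam.trans hc) (sub_pos.2 hc)
  have hM : lam ≤ c + 1 := by linarith
  obtain ⟨C₁, hC₁, hC₁'⟩ := exists_abs_logRatio_le hα hlam hpos hmom hM
  obtain ⟨C₄, hC₄, hC₄'⟩ := exists_abs_mixDensityDeriv_mul_le hα hlam hpos hmom hM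
  have hmeas : AEStronglyMeasurable
      (fun u => mixDensityDeriv α lam μ c u * logRatio α lam μ c u)
      (volume.restrict (Ioi 0)) :=
    (aestronglyMeasurable_mixDensityDeriv hα hlam hpos hmom hc).mul
      (aestronglyMeasurable_of_continuousAt fun u hu =>
        (hasDerivAt_logRatio hα hlam hpos hmom hc.le hu).continuousAt)
  have h := (hasDerivAt_integral_of_dominated_loc_of_deriv_le
    (μ := volume.restrict (Ioi 0)) (F := fun s u => entropyIntegrand α lam μ s u)
    (F' := fun s u => mixDensityDeriv α lam μ s u * logRatio α lam μ s u)
    (bound := fun u => C₁ * C₄ * envelope α u)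
    (Ioo_mem_nhds hc (lt_add_one c)) ?_
    (integrableOn_entropyIntegrand hα hlam hpos hmom hc.le) hmeas ?_
    ((integrableOn_envelope hα0).const_mul _) ?_).2
  · refine h.congr_deriv ?_
    rw [eq_div_iff hcr.ne', mul_comm]
    exact integral_mixDensityDeriv_mul_logRatio hα hlam hpos hmom hc
  · filter_upwards [Ioo_mem_nhds hc (lt_add_one c)] with s hs
    exact aestronglyMeasurable_of_continuousAt fun u hu =>
      continuousAt_entropyIntegrand hα hlam hpos hmom hs.1.le hu
  · refine (ae_restrict_iff' measurableSet_Ioi).2 (ae_of_all _ fun u (hu : 0 < u) s hs => ?_)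
    rw [norm_mul, Real.norm_eq_abs, Real.norm_eq_abs]
    calc _ ≤ |mixDensityDeriv α lam μ s u| * (C₁ * (1 + u)) := by
          gcongr; exact hC₁' s hs.1.le hs.2.le u hu
      _ = C₁ * (|mixDensityDeriv α lam μ s u| * (1 + u)) := by ring
      _ ≤ C₁ * (C₄ * envelope α u) := 
          mul_le_mul_of_nonneg_left (hC₄' s hs.1.le hs.2.le u hu) hC₁
      _ = _ := by ring
  · exact (ae_restrict_iff' measurableSet_Ioi).2 (ae_of_all _ fun u hu s hs =>
      hasDerivAt_entropyIntegrand hα hlam hpos hmom hs.1 hu)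

end Entropy

/-! ### The law of the smart path -/

lemma measurable_gammaPDF (a r : ℝ) : Measurable (gammaPDF a r) :=
  (measurable_gammaPDFReal a r).ennreal_ofReal

lemma gammaMeasure_eq_withDensity_restrict {a r : ℝ} :
    gammaMeasure a r = (volume.restrict (Ioi 0)).withDensity (gammaPDF a r) := by
  rw [restrict_Ioi_eq_restrict_Ici, gammaMeasure, ← withDensity_indicator measurableSet_Ici]
  congr 1
  ext x
  by_cases hx : 0 ≤ x
  · simp [hx]
  · simp [hx, gammaPDF_of_neg (not_le.1 hx)]

lemma integrable_gammaMeasure_iff {a r : ℝ} (ha : 0 < a) (hr : 0 < r) {f : ℝ → ℝ} :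
    Integrable f (gammaMeasure a r) ↔
      IntegrableOn (fun x => gammaPDFReal a r x * f x) (Ioi 0) := by
  rw [gammaMeasure_eq_withDensity_restrict, integrable_withDensity_iff_integrable_smul'
    (measurable_gammaPDF a r) (ae_of_all _ fun _ => ENNReal.ofReal_lt_top)]
  simp [IntegrableOn, gammaPDF, ENNReal.toReal_ofReal (gammaPDFReal_nonneg ha hr _)]

lemma integral_gammaMeasure {a r : ℝ} (ha : 0 < a) (hr : 0 < r) (f : ℝ → ℝ) :
    ∫ x, f x ∂gammaMeasure a r = ∫ x in Ioi 0, gammaPDFReal a r x * f x := by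
  rw [gammaMeasure_eq_withDensity_restrict, integral_withDensity_eq_integral_toReal_smul
    (measurable_gammaPDF a r) (ae_of_all _ fun _ => ENNReal.ofReal_lt_top)]
  simp [gammaPDF, ENNReal.toReal_ofReal (gammaPDFReal_nonneg ha hr _)]

lemma gammaPDFReal_mul_exp {a r t x : ℝ} (hx : 0 < x) :
    gammaPDFReal a r x * Real.exp (t * x) =
      r ^ a / Real.Gamma a * (x ^ (a - 1) * Real.exp (-((r - t) * x))) := by
  rw [gammaPDFReal_of_pos hx, mul_assoc, mul_assoc, ← Real.exp_add]
  ring_nf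

lemma integrable_exp_gammaMeasure {a r t : ℝ} (ha : 0 < a) (hr : 0 < r) (ht : t < r) :
    Integrable (fun x => Real.exp (t * x)) (gammaMeasure a r) := by
  rw [integrable_gammaMeasure_iff ha hr]
  have key := Real.integral_rpow_mul_exp_neg_mul_Ioi ha (sub_pos.2 ht)
  have hG := Real.Gamma_pos_of_pos ha
  have h0 : 0 < r - t := sub_pos.2 ht
  have hint : IntegrableOn (fun x => x ^ (a - 1) * Real.exp (-((r - t) * x))) (Ioi 0) :=
    .of_integral_ne_zero (by rw [key]; positivity)
  exact IntegrableOn.congr_fun (hint.const_mul (r ^ a / Real.Gamma a))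
    (fun x hx => (gammaPDFReal_mul_exp hx).symm) measurableSet_Ioi

lemma mgf_gammaMeasure {a r t : ℝ} (ha : 0 < a) (hr : 0 < r) (ht : t < r) :
    ∫ x, Real.exp (t * x) ∂gammaMeasure a r = (r / (r - t)) ^ a := by
  have hG := Real.Gamma_pos_of_pos ha
  have h0 : 0 < r - t := sub_pos.2 ht
  rw [integral_gammaMeasure ha hr, setIntegral_congr_fun measurableSet_Ioi
    (fun x hx => gammaPDFReal_mul_exp hx), integral_const_mul,
    Real.integral_rpow_mul_exp_neg_mul_Ioi ha h0, Real.div_rpow hr.le h0.le,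
    Real.div_rpow zero_le_one h0.le, Real.one_rpow]
  field_simp

/-- Beyond the abscissa of convergence the moment generating function takes the value `0` by
convention. -/
lemma mgf_gammaMeasure_of_le {a r t : ℝ} (ha : 0 < a) (hr : 0 < r) (ht : r ≤ t) :
    ∫ x, Real.exp (t * x) ∂gammaMeasure a r = 0 := by
  refine integral_undef fun h => not_integrableOn_Ioi_rpow (a - 1) ?_
  rw [integrable_gammaMeasure_iff ha hr] at h
  have hG := Real.Gamma_pos_of_pos ha
  have hm : Measurable fun x : ℝ => x ^ (a - 1) := by fun_prop
  refine Integrable.mono' (h.const_mul (Real.Gamma a / r ^ a)) hm.aestronglyMeasurable ?_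
  refine (ae_restrict_iff' measurableSet_Ioi).2 (ae_of_all _ fun x (hx : 0 < x) => ?_)
  rw [gammaPDFReal_mul_exp hx, Real.norm_of_nonneg (by positivity)]
  have h1 : 1 ≤ Real.exp (-((r - t) * x)) := Real.one_le_exp (by nlinarith)
  have e : Real.Gamma a / r ^ a * (r ^ a / Real.Gamma a *
      (x ^ (a - 1) * Real.exp (-((r - t) * x)))) = x ^ (a - 1) * Real.exp (-((r - t) * x)) := by
    field_simp
  rw [e]
  exact le_mul_of_one_le_right (by positivity) h1

instance (r : ℝ) : IsMarkovKernel (poissonKernel r) :=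
  ⟨fun x => inferInstanceAs (IsProbabilityMeasure (poissonMeasure (r * x).toNNReal))⟩

lemma isMarkovKernel_integerGammaKernel {r : ℝ} (hr : 0 < r) :
    IsMarkovKernel (integerGammaKernel r) := by
  refine ⟨fun k => ?_⟩
  change IsProbabilityMeasure (if k = 0 then Measure.dirac 0 else gammaMeasure k r)
  split_ifs with hk
  · infer_instance
  · exact isProbabilityMeasure_gammaMeasure (by positivity) hr

lemma mgf_integerGammaKernel {r t : ℝ} (hr : 0 < r) (ht : t < r) (k : ℕ) :
    ∫ x, Real.exp (t * x) ∂integerGammaKernel r k = (r / (r - t)) ^ (k : ℝ) := by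
  change ∫ x, Real.exp (t * x) ∂(if k = 0 then Measure.dirac 0 else gammaMeasure k r) = _
  split_ifs with hk
  · simp [hk]
  · exact mgf_gammaMeasure (by positivity) hr ht

/-- A law on the line with the moment generating function of a gamma law is that gamma law. -/
lemma eq_gammaMeasure_of_mgf {ν : Measure ℝ} [IsProbabilityMeasure ν] {a r : ℝ} (ha : 0 < a)
    (hr : 0 < r)
    (h : ∀ t, ∫ x, Real.exp (t * x) ∂ν = ∫ x, Real.exp (t * x) ∂gammaMeasure a r) :
    ν = gammaMeasure a r := by
  have := isProbabilityMeasure_gammaMeasure ha hr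
  have hmgf : mgf id (gammaMeasure a r) = mgf id ν := by
    ext t
    exact (h t).symm
  have hsub : Iio r ⊆ integrableExpSet id (gammaMeasure a r) := fun t ht =>
    integrable_exp_gammaMeasure ha hr ht
  have hint : (0 : ℝ) ∈ interior (integrableExpSet id (gammaMeasure a r)) :=
    interior_maximal hsub isOpen_Iio hr
  refine Measure.ext_of_charFun (funext fun t => ?_)
  rw [← complexMGF_id_mul_I, ← complexMGF_id_mul_I]
  exact (eqOn_complexMGF_of_mgf hmgf (by simpa using hint)).symm

/-- Given `k`, the smart path is a gamma variable of shape `α + k` and rate `lam / (1 - τ)`: both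
summands are gamma variables of that rate. -/
lemma map_prod_integerGammaKernel {α lam τ : ℝ} (hα : 0 < α) (hlam : 0 < lam)
    (hτ : τ ∈ Ioo (0 : ℝ) 1) (k : ℕ) :
    ((gammaMeasure α lam).prod (integerGammaKernel (lam * τ / (1 - τ)) k)).map
      (fun p => (1 - τ) * p.1 + τ * p.2) = gammaMeasure (α + k) (lam / (1 - τ)) := by
  obtain ⟨h0, h1⟩ := hτ
  have h1' : 0 < 1 - τ := by linarith
  have hr : 0 < lam * τ / (1 - τ) := by positivity
  have hc : 0 < lam / (1 - τ) := by positivity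
  have hk : 0 < α + k := by positivity
  have := isMarkovKernel_integerGammaKernel hr
  have := isProbabilityMeasure_gammaMeasure hα hlam
  have hm : Measurable fun p : ℝ × ℝ => (1 - τ) * p.1 + τ * p.2 := by fun_prop
  have := Measure.isProbabilityMeasure_map hm.aemeasurable
    (μ := (gammaMeasure α lam).prod (integerGammaKernel (lam * τ / (1 - τ)) k))
  refine eq_gammaMeasure_of_mgf hk hc fun t => ?_
  rw [integral_map hm.aemeasurable (by fun_prop)]
  have e : ∀ p : ℝ × ℝ, Real.exp (t * ((1 - τ) * p.1 + τ * p.2)) =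
      Real.exp ((1 - τ) * t * p.1) * Real.exp (τ * t * p.2) := by
    intro p
    rw [← Real.exp_add]
    ring_nf
  simp_rw [e]
  rw [integral_prod_mul (fun x => Real.exp ((1 - τ) * t * x)) (fun y => Real.exp (τ * t * y))]
  -- For `lam / (1 - τ) ≤ t` neither integral converges, and both sides take the value `0`.
  rcases lt_or_ge t (lam / (1 - τ)) with ht | ht
  · have ht' : t * (1 - τ) < lam := (lt_div_iff₀ h1').1 ht
    have h2 : (1 - τ) * t < lam := by linarith
    have h3 : τ * t < lam * τ / (1 - τ) := by
      rw [lt_div_iff₀ h1']; nlinarith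
    have h4 : 0 < lam / (1 - τ) - t := sub_pos.2 ht
    rw [mgf_gammaMeasure hα hlam h2, mgf_integerGammaKernel hr h3, mgf_gammaMeasure hk hc ht,
      Real.rpow_add (by positivity)]
    have h5 : lam - (1 - τ) * t ≠ 0 := by linarith
    congr 2
    · field_simp
    · rw [show lam * τ / (1 - τ) = τ * (lam / (1 - τ)) by ring, ← mul_sub,
        mul_div_mul_left _ _ h0.ne']
  · have ht' : lam ≤ t * (1 - τ) := (div_le_iff₀ h1').1 ht
    rw [mgf_gammaMeasure_of_le hα hlam (by linarith), mgf_gammaMeasure_of_le hk hc ht, zero_mul]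

/-- The kernel is the Poisson mixture of gamma densities. -/
lemma tsum_poisson_mul_gammaPDF {α lam c u x : ℝ} (hα : 0 < α) (hlam : 0 < lam) (hc : lam ≤ c)
    (hu : 0 < u) (hx : 0 < x) :
    ∑' k : ℕ, ENNReal.ofReal (Real.exp (-((c - lam) * x)) * ((c - lam) * x) ^ k / k.factorial) *
      gammaPDF (α + k) c u = ENNReal.ofReal (pathKernel α lam c u x) := by
  have hc0 : 0 < c := hlam.trans_le hc
  have hr : 0 ≤ c - lam := by linarith
  have hterm : ∀ k : ℕ, Real.exp (-((c - lam) * x)) * ((c - lam) * x) ^ k / k.factorial *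
      gammaPDFReal (α + k) c u = pathWeight α lam c u x *
        ((c * (c - lam) * u * x) ^ k / ((k.factorial : ℝ) * Real.Gamma (α + k))) := by
    intro k
    have hG : 0 < Real.Gamma (α + k) := Real.Gamma_pos_of_pos (by positivity)
    have e1 : c ^ (α + k) = c ^ α * c ^ k := by rw [Real.rpow_add hc0, Real.rpow_natCast]
    have e2 : u ^ (α + k - 1) = u ^ (α - 1) * u ^ k := by
      rw [add_sub_right_comm, Real.rpow_add hu, Real.rpow_natCast]
    have e3 : Real.exp (-(c * u) - (c - lam) * x) =
        Real.exp (-(c * u)) * Real.exp (-((c - lam) * x)) := by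
      rw [← Real.exp_add]; ring_nf
    rw [gammaPDFReal_of_pos hu, pathWeight, e1, e2, e3]
    simp only [mul_pow]
    field_simp
  have hnonneg : ∀ k : ℕ, 0 ≤ Real.exp (-((c - lam) * x)) * ((c - lam) * x) ^ k / k.factorial :=
    fun k => by positivity
  simp_rw [gammaPDF, ← ENNReal.ofReal_mul (hnonneg _), hterm]
  rw [← ENNReal.ofReal_tsum_of_nonneg, tsum_mul_left]
  · rfl
  · intro k
    have hG : 0 < Real.Gamma (α + k) := Real.Gamma_pos_of_pos (by positivity)
    have := pathWeight_pos (α := α) (lam := lam) (x := x) hc0 hu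
    positivity
  · exact (summable_besselClifford hα _).mul_left _

lemma measurable_uncurry_pathKernel {α : ℝ} (hα : 0 < α) (lam c : ℝ) :
    Measurable (fun p : ℝ × ℝ => pathKernel α lam c p.1 p.2) := by
  have := (continuous_besselClifford hα).measurable
  unfold pathKernel pathWeight
  fun_prop

lemma measurable_mixDensity {α : ℝ} (hα : 0 < α) (lam c : ℝ) (μ : Measure ℝ) [SFinite μ] :
    Measurable (mixDensity α lam μ c) :=
  (StronglyMeasurable.integral_prod_right (f := fun u x => pathKernel α lam c u x)
    (measurable_uncurry_pathKernel hα lam c).stronglyMeasurable).measurable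

lemma lintegral_poissonKernel {r x : ℝ} (hr : 0 ≤ r) (hx : 0 < x) (f : ℕ → ℝ≥0∞) :
    ∫⁻ k, f k ∂poissonKernel r x =
      ∑' k : ℕ, ENNReal.ofReal (Real.exp (-(r * x)) * (r * x) ^ k / k.factorial) * f k := by
  have h : ((r * x).toNNReal : ℝ) = r * x := Real.coe_toNNReal _ (by positivity)
  change ∫⁻ k, f k ∂poissonMeasure (r * x).toNNReal = _
  rw [poissonMeasure, lintegral_sum_measure]
  simp [h]

/-- Disintegration of the smart path along the starting point `x` and the Poisson variable `k`. -/
theorem smartPathLaw_eq_withDensity_mixDensity {α lam τ : ℝ} {μ : Measure ℝ}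
    [IsProbabilityMeasure μ] (hα : 1 / 2 ≤ α) (hlam : 0 < lam) (hpos : ∀ᵐ x ∂μ, 0 < x)
    (hmom : Integrable (fun x => (1 + x) ^ (α + 4)) μ) (hτ : τ ∈ Ioo (0 : ℝ) 1) :
    smartPathLaw α lam τ μ = (volume.restrict (Ioi (0 : ℝ))).withDensity
      (fun u => ENNReal.ofReal (mixDensity α lam μ (lam / (1 - τ)) u)) := by
  have hα0 : 0 < α := by linarith
  obtain ⟨h0, h1⟩ := id hτ
  have h1' : 0 < 1 - τ := by linarith
  set c := lam / (1 - τ) with hc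
  have hcr : lam * τ / (1 - τ) = c - lam := by rw [hc]; field_simp; ring
  have hr : 0 < lam * τ / (1 - τ) := by positivity
  have hcl : lam ≤ c := by linarith [hcr]
  have := isMarkovKernel_integerGammaKernel hr
  have := isProbabilityMeasure_gammaMeasure hα0 hlam
  have hm : Measurable fun p : ℝ × ℝ => (1 - τ) * p.1 + τ * p.2 := by fun_prop
  refine Measure.ext_of_lintegral _ fun f hf => ?_
  have hfm : Measurable fun p : ℝ × ℝ => f ((1 - τ) * p.1 + τ * p.2) := hf.comp hm
  have hF : Measurable fun b => ∫⁻ a, f ((1 - τ) * a + τ * b) ∂gammaMeasure α lam :=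
    hfm.lintegral_prod_left'
  have hκ : ∀ k, ∫⁻ b, ∫⁻ a, f ((1 - τ) * a + τ * b) ∂gammaMeasure α lam
      ∂integerGammaKernel (lam * τ / (1 - τ)) k = ∫⁻ u in Ioi 0, gammaPDF (α + k) c u * f u := by
    intro k
    rw [← lintegral_prod_symm' _ hfm, ← lintegral_map hf hm,
      map_prod_integerGammaKernel hα0 hlam hτ k, gammaMeasure_eq_withDensity_restrict,
      lintegral_withDensity_eq_lintegral_mul _ (measurable_gammaPDF _ _) hf]
    rfl
  have hq := measurable_uncurry_pathKernel hα0 lam c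
  calc ∫⁻ z, f z ∂smartPathLaw α lam τ μ
      = ∫⁻ b, ∫⁻ a, f ((1 - τ) * a + τ * b) ∂gammaMeasure α lam ∂mixtureLaw lam τ μ := by
        have : SFinite (mixtureLaw lam τ μ) := by unfold mixtureLaw; infer_instance
        rw [smartPathLaw, lintegral_map hf hm, lintegral_prod_symm' _ hfm]
    _ = ∫⁻ x, ∫⁻ k, (∫⁻ u in Ioi 0, gammaPDF (α + k) c u * f u)
          ∂poissonKernel (lam * τ / (1 - τ)) x ∂μ := by
        rw [mixtureLaw, Measure.lintegral_bind (Kernel.aemeasurable _) hF.aemeasurable,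
          Measure.lintegral_bind (Kernel.aemeasurable _) (by fun_prop)]
        simp_rw [hκ]
    _ = ∫⁻ x, (∫⁻ u in Ioi 0, ENNReal.ofReal (pathKernel α lam c u x) * f u) ∂μ := by
        refine lintegral_congr_ae (hpos.mono fun x hx => ?_)
        have hx : 0 < x := hx
        simp only
        rw [lintegral_poissonKernel hr.le hx, hcr]
        have hmk : ∀ k : ℕ, Measurable fun u => gammaPDF (α + k) c u * f u := fun k =>
          (measurable_gammaPDF _ _).mul hf
        simp_rw [← lintegral_const_mul _ (hmk _)]
        rw [← lintegral_tsum (fun k => ((hmk k).const_mul _).aemeasurable)]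
        refine setLIntegral_congr_fun measurableSet_Ioi fun u hu => ?_
        rw [← tsum_poisson_mul_gammaPDF hα0 hlam hcl hu hx, ← ENNReal.tsum_mul_right]
        simp_rw [mul_assoc]
    _ = ∫⁻ u in Ioi 0, ∫⁻ x, ENNReal.ofReal (pathKernel α lam c u x) * f u ∂μ := by
        refine lintegral_lintegral_swap (Measurable.aemeasurable ?_)
        exact (hq.comp measurable_swap).ennreal_ofReal.mul (hf.comp measurable_snd)
    _ = ∫⁻ u in Ioi 0, ENNReal.ofReal (mixDensity α lam μ c u) * f u := by
        refine setLIntegral_congr_fun measurableSet_Ioi fun u hu => ?_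
        have hu : 0 < u := hu
        rw [lintegral_mul_const _
          (continuous_pathKernel hα0 lam c u).measurable.ennreal_ofReal, mixDensity,
          ofReal_integral_eq_lintegral_ofReal (integrable_pathKernel hα hlam hpos hmom hcl hu)
          (hpos.mono fun x hx => (pathKernel_pos hα0 hlam hcl hu (le_of_lt hx)).le)]
    _ = _ := by
        rw [lintegral_withDensity_eq_lintegral_mul _
          (measurable_mixDensity hα0 lam c μ).ennreal_ofReal hf]
        rfl

/-! ### The relative entropy and the Fisher information of the smart path -/

section Transfer

variable {α lam τ c u : ℝ} {μ : Measure ℝ}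

lemma lt_rate (hlam : 0 < lam) (hτ : τ ∈ Ioo (0 : ℝ) 1) : lam < lam / (1 - τ) := by
  obtain ⟨h0, h1⟩ := hτ
  rw [lt_div_iff₀ (by linarith)]
  nlinarith

/-- The prefactors of the Bessel form of the density combine with the power of the argument that
relates `I_{α - 1}` to `besselClifford α`. -/
lemma smartPathDensity_eq_mixDensity (hlam : 0 < lam)
    (hpos : ∀ᵐ x ∂μ, 0 < x) (hτ : τ ∈ Ioo (0 : ℝ) 1) (hu : 0 < u) :
    smartPathDensity α lam τ μ u = mixDensity α lam μ (lam / (1 - τ)) u := by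
  have hcl := lt_rate hlam hτ
  obtain ⟨h0, h1⟩ := hτ
  have h1' : 0 < 1 - τ := by linarith
  have hrestr : μ.restrict (Ioi 0) = μ := Measure.restrict_eq_self_of_ae_mem hpos
  rw [smartPathDensity, mixDensity, hrestr, ← integral_const_mul]
  refine integral_congr_ae (hpos.mono fun x hx => ?_)
  have hx : 0 < x := hx
  set c := lam / (1 - τ) with hc
  have hc0 : 0 < c := hlam.trans hcl
  have hcr : c - lam = τ * c := by rw [hc]; field_simp; ring
  have hz : 0 < c * (c - lam) * u * x := by rw [hcr]; positivity
  have e1 : 2 * lam * √(u * x * τ) / (1 - τ) = 2 * √(c * (c - lam) * u * x) := by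
    have : c * (c - lam) * u * x = c ^ 2 * (u * x * τ) := by rw [hcr]; ring
    rw [this, Real.sqrt_mul (sq_nonneg c) (u * x * τ), Real.sqrt_sq hc0.le, hc]
    ring
  have e2 : (u / τ) ^ ((α - 1) / 2) * (1 / x) ^ ((α - 1) / 2) *
      (c * (c - lam) * u * x) ^ ((α - 1) / 2) = c ^ (α - 1) * u ^ (α - 1) := by
    rw [← Real.mul_rpow (by positivity) (by positivity),
      ← Real.mul_rpow (by positivity) hz.le, ← Real.mul_rpow hc0.le hu.le]
    have : u / τ * (1 / x) * (c * (c - lam) * u * x) = (c * u) ^ (2 : ℝ) := by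
      rw [hcr, Real.rpow_two]
      field_simp
    rw [this, ← Real.rpow_mul (by positivity)]
    congr 1
    ring
  have e3 : c * c ^ (α - 1) = c ^ α := by
    rw [Real.rpow_sub_one hc0.ne']; field_simp
  have e4 : Real.exp (-(lam * u / (1 - τ))) * Real.exp (-(lam * τ * x / (1 - τ))) =
      Real.exp (-(c * u) - (c - lam) * x) := by
    rw [← Real.exp_add, hcr, hc]
    ring_nf
  simp only
  rw [e1, besselI_eq_besselClifford hz, pathKernel, pathWeight, ← e3, ← e4]
  linear_combination (c * Real.exp (-(lam * u / (1 - τ))) *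
    Real.exp (-(lam * τ * x / (1 - τ))) * besselClifford α (c * (c - lam) * u * x)) * e2

lemma klDiv_smartPathLaw [IsProbabilityMeasure μ] (hα : 1 / 2 ≤ α) (hlam : 0 < lam)
    (hpos : ∀ᵐ x ∂μ, 0 < x) (hmom : Integrable (fun x => (1 + x) ^ (α + 4)) μ)
    (hτ : τ ∈ Ioo (0 : ℝ) 1) :
    InformationTheory.klDiv (smartPathLaw α lam τ μ) (gammaMeasure α lam) =
      ENNReal.ofReal (∫ u in Ioi 0, entropyIntegrand α lam μ (lam / (1 - τ)) u) := by
  have hα0 : 0 < α := by linarith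
  have hcl := (lt_rate hlam hτ).le
  have := isProbabilityMeasure_gammaMeasure hα0 hlam
  set c := lam / (1 - τ) with hc
  set R : ℝ → ℝ := fun u => mixDensity α lam μ c u / gammaPDFReal α lam u with hR
  have hRm : Measurable R :=
    (measurable_mixDensity hα0 lam c μ).div (measurable_gammaPDFReal α lam)
  have hlaw : smartPathLaw α lam τ μ =
      (gammaMeasure α lam).withDensity (fun u => ENNReal.ofReal (R u)) := by
    rw [smartPathLaw_eq_withDensity_mixDensity hα hlam hpos hmom hτ,
      gammaMeasure_eq_withDensity_restrict,
      ← withDensity_mul _ (measurable_gammaPDF α lam) hRm.ennreal_ofReal]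
    refine withDensity_congr_ae
      ((ae_restrict_iff' measurableSet_Ioi).2 (ae_of_all _ fun u (hu : 0 < u) => ?_))
    have hγ := gammaPDFReal_pos hα0 hlam hu
    simp only [Pi.mul_apply]
    rw [gammaPDF, ← ENNReal.ofReal_mul hγ.le, hR]
    congr 1
    field_simp
    rfl
  have hac : smartPathLaw α lam τ μ ≪ gammaMeasure α lam := by
    rw [hlaw]
    exact withDensity_absolutelyContinuous _ _
  have hprob : IsProbabilityMeasure (smartPathLaw α lam τ μ) := by
    have hr : 0 < lam * τ / (1 - τ) := by
      have h1 : 0 < 1 - τ := by linarith [hτ.2]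
      have h0 := hτ.1
      positivity
    have := isMarkovKernel_integerGammaKernel hr
    have : IsProbabilityMeasure (mixtureLaw lam τ μ) := by
      unfold mixtureLaw
      infer_instance
    exact Measure.isProbabilityMeasure_map (by fun_prop)
  rw [InformationTheory.klDiv_eq_lintegral_klFun_of_ac hac]
  have hrn : (smartPathLaw α lam τ μ).rnDeriv (gammaMeasure α lam) =ᵐ[gammaMeasure α lam]
      fun u => ENNReal.ofReal (R u) := by
    rw [hlaw]
    exact Measure.rnDeriv_withDensity _ hRm.ennreal_ofReal
  have hkl : Measurable fun u =>
      ENNReal.ofReal (InformationTheory.klFun (ENNReal.ofReal (R u)).toReal) :=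
    (InformationTheory.measurable_klFun.comp hRm.ennreal_ofReal.ennreal_toReal).ennreal_ofReal
  rw [lintegral_congr_ae (hrn.mono fun u hu => by simp only [hu] :
    (fun u => ENNReal.ofReal (InformationTheory.klFun
      ((smartPathLaw α lam τ μ).rnDeriv (gammaMeasure α lam) u).toReal)) =ᵐ[gammaMeasure α lam]
      fun u => ENNReal.ofReal (InformationTheory.klFun (ENNReal.ofReal (R u)).toReal)),
    gammaMeasure_eq_withDensity_restrict,
    lintegral_withDensity_eq_lintegral_mul _ (measurable_gammaPDF α lam) hkl]
  have hpt : ∀ u, 0 < u → 0 ≤ R u := fun u hu =>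
    (div_pos (mixDensity_pos hα hlam hpos hmom hcl hu) (gammaPDFReal_pos hα0 hlam hu)).le
  rw [ofReal_integral_eq_lintegral_ofReal
    (integrableOn_entropyIntegrand hα hlam hpos hmom hcl)]
  · refine setLIntegral_congr_fun measurableSet_Ioi fun u hu => ?_
    have hγ := gammaPDFReal_pos hα0 hlam hu
    simp only [Pi.mul_apply]
    rw [gammaPDF, ← ENNReal.ofReal_mul hγ.le, ENNReal.toReal_ofReal (hpt u hu)]
    rfl
  · refine (ae_restrict_iff' measurableSet_Ioi).2 (ae_of_all _ fun u hu => ?_)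
    exact mul_nonneg (gammaPDFReal_pos hα0 hlam hu).le
      (InformationTheory.klFun_nonneg (hpt u hu))

/-- The score of the smart path exceeds the gamma score by `Φ / (u g)`, where `Φ` is the flux. -/
lemma gammaFisherInfo_smartPathDensity [IsProbabilityMeasure μ] (hα : 1 / 2 ≤ α) (hlam : 0 < lam)
    (hpos : ∀ᵐ x ∂μ, 0 < x) (hmom : Integrable (fun x => (1 + x) ^ (α + 4)) μ)
    (hτ : τ ∈ Ioo (0 : ℝ) 1) :
    gammaFisherInfo α lam (smartPathDensity α lam τ μ) =
      ENNReal.ofReal (∫ u in Ioi 0, mixFlux α lam μ (lam / (1 - τ)) u ^ 2 /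
        (u * mixDensity α lam μ (lam / (1 - τ)) u)) := by
  have hcl := (lt_rate hlam hτ).le
  rw [gammaFisherInfo, ofReal_integral_eq_lintegral_ofReal
    (integrableOn_sq_mixFlux_div hα hlam hpos hmom hcl)]
  · refine setLIntegral_congr_fun measurableSet_Ioi fun u (hu : 0 < u) => ?_
    have hg := mixDensity_pos hα hlam hpos hmom hcl hu
    have heq : (fun v => Real.log (smartPathDensity α lam τ μ v)) =ᶠ[𝓝 u]
        fun v => Real.log (mixDensity α lam μ (lam / (1 - τ)) v) :=
      (eventually_gt_nhds hu).mono fun v hv =>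
        congrArg Real.log (smartPathDensity_eq_mixDensity hlam hpos hτ hv)
    have hscore : score (smartPathDensity α lam τ μ) u = gammaScore α lam u +
        mixFlux α lam μ (lam / (1 - τ)) u / (u * mixDensity α lam μ (lam / (1 - τ)) u) := by
      rw [score, heq.deriv_eq,
        ((hasDerivAt_mixDensity hα hlam hpos hmom hcl hu).log hg.ne').deriv]
      field_simp
    rw [hscore, smartPathDensity_eq_mixDensity hlam hpos hτ hu, add_sub_cancel_left]
    congr 1
    field_simp
  · refine (ae_restrict_iff' measurableSet_Ioi).2 (ae_of_all _ fun u (hu : 0 < u) => ?_)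
    have hg := mixDensity_pos hα hlam hpos hmom hcl hu
    exact div_nonneg (sq_nonneg _) (mul_pos hu hg).le

lemma integrable_one_add_rpow [IsFiniteMeasure μ] {p : ℝ} (hp : 0 ≤ p)
    (hpos : ∀ᵐ x ∂μ, 0 < x) (hmom : Integrable (fun x => x ^ p) μ) :
    Integrable (fun x => (1 + x) ^ p) μ := by
  have hm : Measurable fun x : ℝ => (1 + x) ^ p := by fun_prop
  refine (((integrable_const (1 : ℝ)).add hmom).const_mul (2 ^ p)).mono' hm.aestronglyMeasurable
    (hpos.mono fun x hx => ?_)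
  have hx : 0 < x := hx
  rw [Real.norm_of_nonneg (by positivity)]
  change (1 + x) ^ p ≤ 2 ^ p * (1 + x ^ p)
  have h1 : (1 + x) ^ p ≤ (2 * max 1 x) ^ p :=
    Real.rpow_le_rpow (by positivity) (by linarith [le_max_left 1 x, le_max_right 1 x]) hp
  rw [Real.mul_rpow (by norm_num) (by positivity)] at h1
  refine h1.trans (mul_le_mul_of_nonneg_left ?_ (by positivity))
  have hxp : 0 < x ^ p := by positivity
  rcases max_choice 1 x with h | h <;> rw [h]
  · rw [Real.one_rpow]; linarith
  · linarith

end Transfer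

end GammaSmartPath

theorem mainTheorem1 {Ω : Type*} [MeasurableSpace Ω] (P : Measure Ω) [IsProbabilityMeasure P]
    (α lam : ℝ) (hα : 1 / 2 ≤ α) (hlam : 0 < lam)
    (X : Ω → ℝ) (hX : AEMeasurable X P) (hpos : ∀ᵐ ω ∂P, 0 < X ω)
    (hmom : Integrable (fun ω => X ω ^ (α + 4)) P) :
    ∀ τ ∈ Ioo (0 : ℝ) 1,
      (∀ u ∈ Ioi (0 : ℝ), 0 < GammaSmartPath.smartPathDensity α lam τ (P.map X) u ∧
        DifferentiableAt ℝ (GammaSmartPath.smartPathDensity α lam τ (P.map X)) u) ∧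
      GammaSmartPath.smartPathLaw α lam τ (P.map X) =
        (volume.restrict (Ioi (0 : ℝ))).withDensity
          (fun u => ENNReal.ofReal (GammaSmartPath.smartPathDensity α lam τ (P.map X) u)) ∧
      InformationTheory.klDiv (GammaSmartPath.smartPathLaw α lam τ (P.map X))
        (gammaMeasure α lam) ≠ ∞ ∧
      GammaSmartPath.gammaFisherInfo α lam
        (GammaSmartPath.smartPathDensity α lam τ (P.map X)) ≠ ∞ ∧
      HasDerivAt
        (fun s : ℝ => (InformationTheory.klDiv (GammaSmartPath.smartPathLaw α lam s (P.map X))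
          (gammaMeasure α lam)).toReal)
        ((GammaSmartPath.gammaFisherInfo α lam
          (GammaSmartPath.smartPathDensity α lam τ (P.map X))).toReal / (lam * τ)) τ := by
  open GammaSmartPath in
  intro τ hτ
  have hprob : IsProbabilityMeasure (P.map X) := Measure.isProbabilityMeasure_map hX
  have hpos' : ∀ᵐ x ∂P.map X, 0 < x := (ae_map_iff hX measurableSet_Ioi).2 hpos
  have hm : Measurable fun x : ℝ => x ^ (α + 4) := by fun_prop
  have hmom' : Integrable (fun x => (1 + x) ^ (α + 4)) (P.map X) :=
    integrable_one_add_rpow (by linarith) hpos'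
      ((integrable_map_measure hm.aestronglyMeasurable hX).2 hmom)
  generalize P.map X = μ at hprob hpos' hmom'
  have hcl := lt_rate hlam hτ
  have hden : ∀ u, 0 < u →
      smartPathDensity α lam τ μ u = mixDensity α lam μ (lam / (1 - τ)) u :=
    fun u hu => smartPathDensity_eq_mixDensity hlam hpos' hτ hu
  have hFisher := gammaFisherInfo_smartPathDensity hα hlam hpos' hmom' hτ
  refine ⟨fun u (hu : 0 < u) => ⟨?_, ?_⟩, ?_, ?_, ?_, ?_⟩
  · rw [hden u hu]
    exact mixDensity_pos hα hlam hpos' hmom' hcl.le hu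
  · exact ((hasDerivAt_mixDensity hα hlam hpos' hmom' hcl.le hu).congr_of_eventuallyEq
      ((eventually_gt_nhds hu).mono hden)).differentiableAt
  · rw [smartPathLaw_eq_withDensity_mixDensity hα hlam hpos' hmom' hτ]
    exact withDensity_congr_ae ((ae_restrict_iff' measurableSet_Ioi).2
      (ae_of_all _ fun u hu => by simp only [hden u hu]))
  · rw [klDiv_smartPathLaw hα hlam hpos' hmom' hτ]
    exact ENNReal.ofReal_ne_top
  · rw [hFisher]
    exact ENNReal.ofReal_ne_top
  · have h1 : (1 - τ) ≠ 0 := by linarith [hτ.2]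
    have h0 : τ ≠ 0 := hτ.1.ne'
    have hJ : 0 ≤ ∫ u in Ioi 0, mixFlux α lam μ (lam / (1 - τ)) u ^ 2 /
        (u * mixDensity α lam μ (lam / (1 - τ)) u) :=
      setIntegral_nonneg measurableSet_Ioi fun u (hu : 0 < u) => div_nonneg (sq_nonneg _)
        (mul_pos hu (mixDensity_pos hα hlam hpos' hmom' hcl.le hu)).le
    have hrate : HasDerivAt (fun s : ℝ => lam / (1 - s)) (lam / (1 - τ) ^ 2) τ := by
      refine (((hasDerivAt_id τ).const_sub 1).fun_inv h1 |>.const_mul lam).congr_deriv ?_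
      simp only [id]
      ring
    have hD := (hasDerivAt_integral_entropyIntegrand hα hlam hpos' hmom' hcl).comp τ hrate
    rw [hFisher, ENNReal.toReal_ofReal hJ]
    refine (hD.congr_of_eventuallyEq ?_).congr_deriv ?_
    · filter_upwards [isOpen_Ioo.mem_nhds hτ] with s hs
      have hcs := lt_rate hlam hs
      rw [klDiv_smartPathLaw hα hlam hpos' hmom' hs, ENNReal.toReal_ofReal]
      · rfl
      · exact setIntegral_nonneg measurableSet_Ioi fun u (hu : 0 < u) =>
          mul_nonneg (gammaPDFReal_pos (by linarith) hlam hu).le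
            (InformationTheory.klFun_nonneg (div_pos
              (mixDensity_pos hα hlam hpos' hmom' hcs.le hu)
              (gammaPDFReal_pos (by linarith) hlam hu)).le)
    -- With `c = lam / (1 - τ)`, one has `c (c - lam) = lam² τ / (1 - τ)²`.
    · have hc : lam / (1 - τ) * (lam / (1 - τ) - lam) = lam ^ 2 * τ / (1 - τ) ^ 2 := by
        field_simp
        ring
      rw [hc]
      field_simp
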